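/- Write points of $\mathbb R\times\mathbb R^3$ as $(t,x)$, put $x_0=t$, $\partial_0=\partial_t$, and let $\Box=\partial_t^2-\sum_{k=1}^3\partial_k^2$. Let $\Gamma$ range over the ten vector fields $\partial_j$ ($0\le j\le 3$), $\Omega_{jk}=x_j\partial_k-x_k\partial_j$ ($1\le j<k\le 3$) and $\Omega_{0k}=x_k\partial_t+t\partial_k$ ($1\le k\le 3$). Let $\Gamma^\alpha$ with $|\alpha|=n$ range over all products of $n$ of these vector fields, and let $\|\cdot\|_2$ be the norm of $L^2(\mathbb R^3)$ in the variable $x$. Proposition. For every $B>0$ there is a constant $C$, depending only on $B$, with the following property. Suppose that $w\in C^\infty(\mathbb R\times\mathbb R^3)$ is real valued, that $w(t,x)=0$ for $t\le 2B$, and that $\Box w(t,x)=0$ for $|x|>t-B$. Then for every $t\in\mathbb R$ $$(1+t)\,\sup_{x\in\mathbb R^3}|\partial_{t,x}w(t,x)|\;\le\; C\sum_{|\alpha|\le 2}\;\sum_{k\in\mathbb Z}\;\sup_{\tau\in[2^{k-1},2^{k+1}]\cap[2B,t]}2^k\,\|\Gamma^\alpha\Box w(\tau,\cdot)\|_2 ,$$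 where $|\partial_{t,x}w|=\bigl(\sum_{j=0}^3|\partial_jw|^2\bigr)^{1/2}$ and a supremum over the empty set is $0$. -/

import Mathlib

open scoped ENNReal NNReal ContDiff

noncomputable section

namespace WaveDecay

/-- Space, with the Euclidean norm and Lebesgue measure. -/
abbrev Space : Type := EuclideanSpace ℝ (Fin 3)

/-- Space-time `ℝ × ℝ³`, with points `(t, x)`. -/
abbrev SpaceTime : Type := ℝ × Space

/-- The coordinate `x_j` of a space-time point, where `x_0 = t`. -/
def coord (j : Fin 4) (p : SpaceTime) : ℝ :=
  Fin.cases p.1 (fun k : Fin 3 => p.2 k) j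

/-- The standard basis vector of space-time in the direction `x_j`. -/
def basisVec (j : Fin 4) : SpaceTime :=
  Fin.cases ((1, 0) : SpaceTime) (fun k : Fin 3 => (0, EuclideanSpace.single k (1 : ℝ))) j

/-- The partial derivative `∂_j`, where `∂_0 = ∂_t`. -/
def pd (j : Fin 4) (f : SpaceTime → ℝ) (p : SpaceTime) : ℝ :=
  fderiv ℝ f p (basisVec j)

/-- The length `|∂_{t,x} f|` of the space-time gradient. -/
def gradNorm (f : SpaceTime → ℝ) (p : SpaceTime) : ℝ :=
  Real.sqrt (∑ j : Fin 4, pd j f p ^ 2)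

/-- The d'Alembertian `∂_t² - Δ`. -/
def box (f : SpaceTime → ℝ) (p : SpaceTime) : ℝ :=
  pd 0 (pd 0 f) p - ∑ k : Fin 3, pd k.succ (pd k.succ f) p

/-- The vector fields `Ω_{jk}`: the Lorentz boosts `Ω_{0k} = x_k ∂_t + t ∂_k` and the rotations
`Ω_{jk} = x_j ∂_k - x_k ∂_j` for `1 ≤ j`. -/
def Omega (j k : Fin 4) (f : SpaceTime → ℝ) (p : SpaceTime) : ℝ :=
  if j = 0 then coord k p * pd 0 f p + coord 0 p * pd k f p
  else coord j p * pd k f p - coord k p * pd j f p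

/-- Labels of the ten vector fields `∂_j` (`0 ≤ j ≤ 3`) and `Ω_{jk}` (`0 ≤ j < k ≤ 3`). -/
abbrev GammaIndex : Type := Fin 4 ⊕ {q : Fin 4 × Fin 4 // q.1 < q.2}

/-- The vector field with a given label, acting on functions. -/
def Gamma (i : GammaIndex) (f : SpaceTime → ℝ) : SpaceTime → ℝ :=
  match i with
  | Sum.inl j => pd j f
  | Sum.inr q => Omega q.1.1 q.1.2 f

/-- The product `Γ^α = Γ_{α 0} ⋯ Γ_{α (n-1)}` of length `|α| = n`. The fields do not commute, so
`α` is an arbitrary word in the labels. -/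
def GammaPow {n : ℕ} (α : Fin n → GammaIndex) (f : SpaceTime → ℝ) : SpaceTime → ℝ :=
  (List.ofFn α).foldr Gamma f

/-- The norm `‖g(τ, ·)‖₂` on `L²(ℝ³)`, with value `∞` if `g(τ, ·)` is not square integrable. -/
def sliceNorm (g : SpaceTime → ℝ) (τ : ℝ) : ℝ≥0∞ :=
  MeasureTheory.eLpNorm (fun x : Space => g (τ, x)) 2 MeasureTheory.volume

/-- The sum over all integers `k` of the suprema of `2^k ‖g(τ, ·)‖₂` over
`τ ∈ [2^(k-1), 2^(k+1)] ∩ [a, t]`; the supremum over an empty set is `0`. -/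
def dyadicSum (a t : ℝ) (g : SpaceTime → ℝ) : ℝ≥0∞ :=
  ∑' k : ℤ, ⨆ τ ∈ Set.Icc ((2 : ℝ) ^ (k - 1)) ((2 : ℝ) ^ (k + 1)) ∩ Set.Icc a t,
    ENNReal.ofReal ((2 : ℝ) ^ k) * sliceNorm g τ

end WaveDecay

end

/-!
The proof combines the energy inequality with weighted Sobolev inequalities at a fixed time.

Since `□` commutes with the fields `Γ`, the energy inequality bounds `‖∂ Γ^α w(T)‖₂` by `∫ ‖Γ^α
□w(τ)‖₂ dτ`, and splitting this integral at the times `2^k` bounds it by the dyadic sum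
(`sliceNorm_pd_le_dyadicSum`). As the commutator of `Γ` with a translation is a combination of
translations, all `‖Γ^α ∂_j w(T)‖₂` with `|α| ≤ 2` are then under control
(`lintegral_gammaDensity_pd_le_wordSum`). It remains to bound `T |∂_j w(T, X)|` by these norms and
by `T ‖Γ^α □w(T)‖₂` with `|α| ≤ 1`, the latter being dominated by a single term of the dyadic sum.

For `|X| ≥ T / 2` (`exists_exterior_bound`) the translations and the rotations suffice: the radial
map `radialShift` pulls a shell of radius `|X|` and bounded thickness back to a shell around the
unit sphere. There `∂_r` and the rotations span all directions with bounded coefficients, and the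
change of variables gains the factor `|X|⁻¹` in `L²`.

For `|X| ≤ T / 2` (`exists_interior_bound`) the boosts `Ω_{0k}` express `∂_k` through `∂_t` up to
a gain of `T⁻¹`, and `□` expresses `∂_t²` in the same way, so that `|∂² v| ≤ C (|□v| + T⁻¹ ∑ |Γ ∂
v|)` in `|x| ≤ 3 T / 4`. With `v = w` and `v = ∂_j w` this bounds the first and second derivatives
of `∂_j w`, which control `|∂_j w(T, X)|`.

Both regions use `exists_local_sobolev`, which follows from a Hardy inequality on the rays through
`X`.
-/

namespace WaveDecay

/-! ### The vector fields and their commutators -/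

theorem contDiff_pd {f : SpaceTime → ℝ} (hf : ContDiff ℝ ∞ f) (j : Fin 4) :
    ContDiff ℝ ∞ (pd j f) :=
  (hf.fderiv_right (m := ∞) (by simp)).clm_apply contDiff_const

theorem contDiff_coord (j : Fin 4) : ContDiff ℝ ∞ (coord j) := by
  refine Fin.cases ?_ (fun k => ?_) j
  · exact contDiff_fst
  · change ContDiff ℝ ∞ (fun p : SpaceTime => p.2 k)
    fun_prop

theorem pd_coord (i j : Fin 4) (p : SpaceTime) : pd i (coord j) p = if i = j then 1 else 0 := by
  refine Fin.cases ?_ (fun k => ?_) j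
  · have h : coord 0 = (ContinuousLinearMap.fst ℝ ℝ Space : SpaceTime → ℝ) := rfl
    rw [pd, h, ContinuousLinearMap.fderiv]
    refine Fin.cases ?_ (fun l => ?_) i
    · rfl
    · simp [basisVec]
  · have h : coord k.succ = ((EuclideanSpace.proj k : Space →L[ℝ] ℝ).comp
        (ContinuousLinearMap.snd ℝ ℝ Space) : SpaceTime → ℝ) := rfl
    rw [pd, h, ContinuousLinearMap.fderiv]
    refine Fin.cases ?_ (fun l => ?_) i
    · simp [basisVec, (Fin.succ_ne_zero k).symm]
    · simp [basisVec, eq_comm]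

theorem pd_mul {f g : SpaceTime → ℝ} (hf : ContDiff ℝ ∞ f) (hg : ContDiff ℝ ∞ g) (i : Fin 4) :
    pd i (fun p => f p * g p) = fun p => f p * pd i g p + pd i f p * g p := by
  ext p
  have h1 := hf.differentiable (by simp) p
  have h2 := hg.differentiable (by simp) p
  simp only [pd]
  rw [fderiv_fun_mul h1 h2]
  simp [mul_comm]

theorem pd_add {f g : SpaceTime → ℝ} (hf : ContDiff ℝ ∞ f) (hg : ContDiff ℝ ∞ g) (i : Fin 4) :
    pd i (fun p => f p + g p) = fun p => pd i f p + pd i g p := by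
  ext p
  have h1 := hf.differentiable (by simp) p
  have h2 := hg.differentiable (by simp) p
  simp only [pd]
  rw [fderiv_fun_add h1 h2]
  rfl

theorem pd_sub {f g : SpaceTime → ℝ} (hf : ContDiff ℝ ∞ f) (hg : ContDiff ℝ ∞ g) (i : Fin 4) :
    pd i (fun p => f p - g p) = fun p => pd i f p - pd i g p := by
  ext p
  have h1 := hf.differentiable (by simp) p
  have h2 := hg.differentiable (by simp) p
  simp only [pd]
  rw [fderiv_fun_sub h1 h2]
  rfl

theorem pd_const_mul {f : SpaceTime → ℝ} (hf : ContDiff ℝ ∞ f) (c : ℝ) (i : Fin 4) :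
    pd i (fun p => c * f p) = fun p => c * pd i f p := by
  ext p
  simp only [pd]
  rw [fderiv_const_mul (hf.differentiable (by simp) p)]
  rfl

theorem pd_sum {ι : Type*} (s : Finset ι) {f : ι → SpaceTime → ℝ}
    (hf : ∀ m, ContDiff ℝ ∞ (f m)) (i : Fin 4) :
    pd i (fun p => ∑ m ∈ s, f m p) = fun p => ∑ m ∈ s, pd i (f m) p := by
  ext p
  simp only [pd]
  rw [fderiv_fun_sum (fun m _ => (hf m).differentiable (by simp) p)]
  simp

theorem pd_comm {f : SpaceTime → ℝ} (hf : ContDiff ℝ ∞ f) (i j : Fin 4) :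
    pd i (pd j f) = pd j (pd i f) := by
  have key : ∀ (a b : Fin 4) (p : SpaceTime),
      pd a (pd b f) p = fderiv ℝ (fderiv ℝ f) p (basisVec a) (basisVec b) := by
    intro a b p
    have h : DifferentiableAt ℝ (fderiv ℝ f) p :=
      (hf.fderiv_right (m := ∞) (by simp)).differentiable (by simp) p
    change fderiv ℝ (fun q => fderiv ℝ f q (basisVec b)) p (basisVec a) = _
    rw [fderiv_clm_apply h (differentiableAt_const _)]
    simp
  ext p
  rw [key, key]
  exact (hf.contDiffAt.isSymmSndFDerivAt
    (by simpa using WithTop.coe_le_coe.2 (le_top : (2 : ℕ∞) ≤ ⊤))).eq _ _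

theorem contDiff_box {f : SpaceTime → ℝ} (hf : ContDiff ℝ ∞ f) : ContDiff ℝ ∞ (box f) :=
  (contDiff_pd (contDiff_pd hf _) _).sub
    (ContDiff.sum fun _ _ => contDiff_pd (contDiff_pd hf _) _)

theorem contDiff_coord_mul {f : SpaceTime → ℝ} (hf : ContDiff ℝ ∞ f) (a : Fin 4) :
    ContDiff ℝ ∞ (fun p => coord a p * f p) := (contDiff_coord a).mul hf

theorem Omega_eq (j k : Fin 4) (f : SpaceTime → ℝ) :
    Omega j k f = if j = 0 then (fun p => coord k p * pd 0 f p + coord 0 p * pd k f p)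
      else (fun p => coord j p * pd k f p - coord k p * pd j f p) := by
  ext p
  unfold Omega
  split_ifs <;> rfl

theorem contDiff_Omega {f : SpaceTime → ℝ} (hf : ContDiff ℝ ∞ f) (j k : Fin 4) :
    ContDiff ℝ ∞ (Omega j k f) := by
  rw [Omega_eq]
  split_ifs
  · exact (contDiff_coord_mul (contDiff_pd hf _) _).add (contDiff_coord_mul (contDiff_pd hf _) _)
  · exact (contDiff_coord_mul (contDiff_pd hf _) _).sub (contDiff_coord_mul (contDiff_pd hf _) _)

theorem contDiff_Gamma {f : SpaceTime → ℝ} (hf : ContDiff ℝ ∞ f) (a : GammaIndex) :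
    ContDiff ℝ ∞ (Gamma a f) := by
  rcases a with j | q
  · exact contDiff_pd hf j
  · exact contDiff_Omega hf _ _

theorem pd_coord_mul {f : SpaceTime → ℝ} (hf : ContDiff ℝ ∞ f) (i a : Fin 4) :
    pd i (fun p => coord a p * f p) =
      fun p => coord a p * pd i f p + (if i = a then 1 else 0) * f p := by
  rw [pd_mul (contDiff_coord a) hf]
  simp only [pd_coord]

theorem pd_pd_coord_mul {f : SpaceTime → ℝ} (hf : ContDiff ℝ ∞ f) (i a : Fin 4) :
    pd i (pd i (fun p => coord a p * f p)) =
      fun p => coord a p * pd i (pd i f) p + 2 * ((if i = a then 1 else 0) * pd i f p) := by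
  rw [pd_coord_mul hf, pd_add (contDiff_coord_mul (contDiff_pd hf _) _) (contDiff_const.mul hf),
    pd_coord_mul (contDiff_pd hf _), pd_const_mul hf]
  ext p
  ring

/-- The diagonal entries of the Minkowski metric. -/
def signature (a : Fin 4) : ℝ := if a = 0 then 1 else -1

theorem box_coord_mul {f : SpaceTime → ℝ} (hf : ContDiff ℝ ∞ f) (a : Fin 4) :
    box (fun p => coord a p * f p) =
      fun p => coord a p * box f p + 2 * signature a * pd a f p := by
  ext p
  simp only [box, pd_pd_coord_mul hf]
  rw [Finset.sum_add_distrib, ← Finset.mul_sum, ← Finset.mul_sum]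
  refine Fin.cases ?_ (fun k => ?_) a
  · simp [signature, Fin.succ_ne_zero]
    ring
  · simp [signature, Fin.succ_ne_zero, (Fin.succ_ne_zero k).symm]
    ring

theorem box_add {f g : SpaceTime → ℝ} (hf : ContDiff ℝ ∞ f) (hg : ContDiff ℝ ∞ g) :
    box (fun p => f p + g p) = fun p => box f p + box g p := by
  ext p
  simp only [box, pd_add hf hg, pd_add (contDiff_pd hf _) (contDiff_pd hg _)]
  rw [Finset.sum_add_distrib]
  ring

theorem box_sub {f g : SpaceTime → ℝ} (hf : ContDiff ℝ ∞ f) (hg : ContDiff ℝ ∞ g) :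
    box (fun p => f p - g p) = fun p => box f p - box g p := by
  ext p
  simp only [box, pd_sub hf hg, pd_sub (contDiff_pd hf _) (contDiff_pd hg _)]
  rw [Finset.sum_sub_distrib]
  ring

theorem box_pd {f : SpaceTime → ℝ} (hf : ContDiff ℝ ∞ f) (j : Fin 4) :
    box (pd j f) = pd j (box f) := by
  have h : ∀ i, pd i (pd i (pd j f)) = pd j (pd i (pd i f)) := fun i => by
    rw [pd_comm hf i j, pd_comm (contDiff_pd hf i) i j]
  ext p
  have hb : box f = fun p => pd 0 (pd 0 f) p - ∑ k : Fin 3, pd k.succ (pd k.succ f) p := rfl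
  rw [hb, pd_sub (contDiff_pd (contDiff_pd hf _) _)
    (ContDiff.sum fun _ _ => contDiff_pd (contDiff_pd hf _) _),
    pd_sum _ (fun m : Fin 3 => contDiff_pd (contDiff_pd hf m.succ) m.succ)]
  simp only [box, h]

theorem box_Omega {f : SpaceTime → ℝ} (hf : ContDiff ℝ ∞ f) {j k : Fin 4} (hk : k ≠ 0) :
    box (Omega j k f) = Omega j k (box f) := by
  rw [Omega_eq, Omega_eq]
  split_ifs with hj
  · rw [box_add (contDiff_coord_mul (contDiff_pd hf _) _)
      (contDiff_coord_mul (contDiff_pd hf _) _), box_coord_mul (contDiff_pd hf _),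
      box_coord_mul (contDiff_pd hf _), box_pd hf, box_pd hf, pd_comm hf k 0]
    ext p
    simp only [signature, hk, if_true, if_false]
    ring
  · rw [box_sub (contDiff_coord_mul (contDiff_pd hf _) _)
      (contDiff_coord_mul (contDiff_pd hf _) _), box_coord_mul (contDiff_pd hf _),
      box_coord_mul (contDiff_pd hf _), box_pd hf, box_pd hf, pd_comm hf k j]
    ext p
    simp only [signature, hk, hj, if_false]
    ring

/-- The d'Alembertian commutes with every field `Γ`: these fields generate isometries of Minkowski
space. -/
theorem box_Gamma {f : SpaceTime → ℝ} (hf : ContDiff ℝ ∞ f) (a : GammaIndex) :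
    box (Gamma a f) = Gamma a (box f) := by
  rcases a with j | ⟨⟨j, k⟩, hjk⟩
  · exact box_pd hf j
  · exact box_Omega hf (Fin.ne_zero_of_lt hjk)

/-- The commutator of a field `Γ` with a translation is a combination of translations. -/
theorem exists_Gamma_pd (a : GammaIndex) (i : Fin 4) :
    ∃ c : Fin 4 → ℝ, (∀ m, |c m| ≤ 1) ∧ ∀ f : SpaceTime → ℝ, ContDiff ℝ ∞ f →
      Gamma a (pd i f) = fun p => pd i (Gamma a f) p + ∑ m, c m * pd m f p := by
  rcases a with j | ⟨⟨j, k⟩, hjk⟩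
  · refine ⟨0, by simp, fun f hf => ?_⟩
    ext p
    simp [Gamma, pd_comm hf i j]
  · have hjk' : j ≠ k := ne_of_lt hjk
    by_cases hj : j = 0
    · refine ⟨fun m => -(if i = k then if m = 0 then 1 else 0 else 0)
        - (if i = 0 then if m = k then 1 else 0 else 0), fun m => ?_, fun f hf => ?_⟩
      · subst hj
        split_ifs <;> simp_all <;> split_ifs <;> simp
      · simp only [Gamma, Omega_eq, hj, if_true]
        rw [pd_add (contDiff_coord_mul (contDiff_pd hf _) _)
          (contDiff_coord_mul (contDiff_pd hf _) _), pd_coord_mul (contDiff_pd hf _),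
          pd_coord_mul (contDiff_pd hf _), pd_comm hf i 0, pd_comm hf i k]
        ext p
        by_cases h1 : i = k <;> by_cases h2 : i = 0 <;>
          simp [h1, h2, sub_mul, Finset.sum_sub_distrib, ite_mul] <;> ring
    · refine ⟨fun m => (if i = k then if m = j then 1 else 0 else 0)
        - (if i = j then if m = k then 1 else 0 else 0), fun m => ?_, fun f hf => ?_⟩
      · split_ifs <;> simp_all <;> split_ifs <;> simp
      · simp only [Gamma, Omega_eq, hj, if_false]
        rw [pd_sub (contDiff_coord_mul (contDiff_pd hf _) _)
          (contDiff_coord_mul (contDiff_pd hf _) _), pd_coord_mul (contDiff_pd hf _),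
          pd_coord_mul (contDiff_pd hf _), pd_comm hf i j, pd_comm hf i k]
        ext p
        by_cases h1 : i = k <;> by_cases h2 : i = j <;>
          simp [h1, h2, sub_mul, Finset.sum_sub_distrib, ite_mul] <;> ring

theorem Gamma_add {f g : SpaceTime → ℝ} (hf : ContDiff ℝ ∞ f) (hg : ContDiff ℝ ∞ g)
    (a : GammaIndex) :
    Gamma a (fun p => f p + g p) = fun p => Gamma a f p + Gamma a g p := by
  rcases a with j | ⟨⟨j, k⟩, hjk⟩
  · exact pd_add hf hg j
  · ext p
    simp only [Gamma, Omega, pd_add hf hg]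
    split_ifs <;> ring

theorem Gamma_const_mul {f : SpaceTime → ℝ} (hf : ContDiff ℝ ∞ f) (c : ℝ) (a : GammaIndex) :
    Gamma a (fun p => c * f p) = fun p => c * Gamma a f p := by
  rcases a with j | ⟨⟨j, k⟩, hjk⟩
  · exact pd_const_mul hf c j
  · ext p
    simp only [Gamma, Omega, pd_const_mul hf]
    split_ifs <;> ring

theorem Gamma_sum {ι : Type*} (s : Finset ι) {f : ι → SpaceTime → ℝ}
    (hf : ∀ m, ContDiff ℝ ∞ (f m)) (a : GammaIndex) :
    Gamma a (fun p => ∑ m ∈ s, f m p) = fun p => ∑ m ∈ s, Gamma a (f m) p := by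
  rcases a with j | ⟨⟨j, k⟩, hjk⟩
  · exact pd_sum s hf j
  · ext p
    simp only [Gamma, Omega, pd_sum s hf]
    split_ifs <;> simp [Finset.sum_add_distrib, Finset.sum_sub_distrib, Finset.mul_sum]

/-! ### The weighted energy identity -/

open MeasureTheory Set Filter Topology

theorem sliceNorm_sq (g : SpaceTime → ℝ) (τ : ℝ) :
    sliceNorm g τ ^ 2 = ∫⁻ x : Space, ENNReal.ofReal (g (τ, x) ^ 2) := by
  have h := eLpNorm_nnreal_pow_eq_lintegral (μ := (volume : Measure Space))
    (f := fun x : Space => g (τ, x)) (p := 2) (by norm_num)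
  have h2 : ((2 : ℝ≥0) : ℝ) = ((2 : ℕ) : ℝ) := by norm_num
  rw [h2] at h
  simp only [ENNReal.rpow_natCast] at h
  rw [sliceNorm]
  refine Eq.trans h (lintegral_congr fun x => ?_)
  rw [← enorm_pow, Real.enorm_eq_ofReal (sq_nonneg _)]

theorem pd_eq_zero_of_eventually {u : SpaceTime → ℝ} {p : SpaceTime} (h : ∀ᶠ q in 𝓝 p, u q = 0)
    (j : Fin 4) : pd j u p = 0 := by
  have h' : u =ᶠ[𝓝 p] fun _ => 0 := h
  rw [pd, h'.fderiv_eq]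
  simp

theorem pd_eq_zero_of_lt {u : SpaceTime → ℝ} {L : ℝ}
    (hu : ∀ p : SpaceTime, L < p.1 + ‖p.2‖ → u p = 0) (j : Fin 4) (p : SpaceTime)
    (hp : L < p.1 + ‖p.2‖) : pd j u p = 0 := by
  refine pd_eq_zero_of_eventually ?_ j
  have : Continuous fun q : SpaceTime => q.1 + ‖q.2‖ := by fun_prop
  filter_upwards [(this.tendsto p).eventually_const_lt hp] with q hq using hu q hq

theorem integrable_slice {u : SpaceTime → ℝ} (hc : Continuous u) {L : ℝ}
    (hu : ∀ p : SpaceTime, L < p.1 + ‖p.2‖ → u p = 0) (t : ℝ) :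
    Integrable fun x : Space => u (t, x) := by
  refine Continuous.integrable_of_hasCompactSupport (by fun_prop) ?_
  refine HasCompactSupport.of_support_subset_isCompact (isCompact_closedBall (0 : Space) (L - t)) ?_
  intro x hx
  rw [mem_closedBall_zero_iff]
  by_contra! h
  exact hx (hu (t, x) (by simp only; linarith))

theorem hasFDerivAt_slice {u : SpaceTime → ℝ} (hu : ContDiff ℝ ∞ u) (t : ℝ) (x : Space) :
    HasFDerivAt (fun y : Space => u (t, y))
      ((fderiv ℝ u (t, x)).comp (ContinuousLinearMap.inr ℝ ℝ Space)) x := by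
  have h1 : HasFDerivAt u (fderiv ℝ u (t, x)) (t, x) :=
    (hu.differentiable (by simp) _).hasFDerivAt
  exact h1.comp x (hasFDerivAt_prodMk_right t x)

theorem hasDerivAt_time {u : SpaceTime → ℝ} (hu : ContDiff ℝ ∞ u) (t : ℝ) (x : Space) :
    HasDerivAt (fun τ : ℝ => u (τ, x)) (pd 0 u (t, x)) t := by
  have h1 : HasFDerivAt u (fderiv ℝ u (t, x)) (t, x) :=
    (hu.differentiable (by simp) _).hasFDerivAt
  have h2 : HasDerivAt (fun τ : ℝ => ((τ, x) : SpaceTime)) ((1, 0) : SpaceTime) t :=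
    (hasDerivAt_id t).prodMk (hasDerivAt_const t x)
  exact h1.comp_hasDerivAt t h2

theorem integral_pd_succ_eq_zero {u : SpaceTime → ℝ} (hc : ContDiff ℝ ∞ u) {L : ℝ}
    (hu : ∀ p : SpaceTime, L < p.1 + ‖p.2‖ → u p = 0) (t : ℝ) (k : Fin 3) :
    ∫ x : Space, pd k.succ u (t, x) = 0 := by
  have hd : ∀ x : Space, fderiv ℝ (fun y : Space => u (t, y)) x (EuclideanSpace.single k 1)
      = pd k.succ u (t, x) := fun x => by
    rw [(hasFDerivAt_slice hc t x).fderiv]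
    rfl
  have h := integral_mul_fderiv_eq_neg_fderiv_mul_of_integrable (μ := (volume : Measure Space))
    (𝕜 := ℝ) (f := fun _ => 1) (g := fun y : Space => u (t, y)) (v := EuclideanSpace.single k 1)
    (by simp) (by
      simp only [hd, one_mul]
      exact integrable_slice (contDiff_pd hc _).continuous (pd_eq_zero_of_lt hu _) t)
    (by simpa using integrable_slice hc.continuous hu t)
    (fun _ _ => by fun_prop) (fun x _ => (hasFDerivAt_slice hc t x).differentiableAt)
  simpa [hd] using h

theorem hasDerivAt_integral_slice {u : SpaceTime → ℝ} (hc : ContDiff ℝ ∞ u) {L : ℝ}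
    (hu : ∀ p : SpaceTime, L < p.1 + ‖p.2‖ → u p = 0) (t : ℝ) :
    HasDerivAt (fun τ => ∫ x : Space, u (τ, x)) (∫ x : Space, pd 0 u (t, x)) t := by
  have hp := (contDiff_pd hc 0).continuous
  obtain ⟨M, hM⟩ := ((isCompact_Icc (a := t - 1) (b := t + 1)).prod
    (isCompact_closedBall (0 : Space) (L - t + 1))).exists_bound_of_continuousOn hp.continuousOn
  refine (hasDerivAt_integral_of_dominated_loc_of_deriv_le (μ := (volume : Measure Space))
    (F := fun τ x => u (τ, x)) (F' := fun τ x => pd 0 u (τ, x)) (s := Icc (t - 1) (t + 1))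
    (bound := (Metric.closedBall (0 : Space) (L - t + 1)).indicator fun _ => M)
    (Icc_mem_nhds (by linarith) (by linarith)) ?_ (integrable_slice hc.continuous hu t) ?_ ?_ ?_
    ?_).2
  · exact Eventually.of_forall fun τ => (integrable_slice hc.continuous hu τ).aestronglyMeasurable
  · exact (integrable_slice hp (pd_eq_zero_of_lt hu 0) t).aestronglyMeasurable
  · refine Eventually.of_forall fun x τ hτ => ?_
    by_cases hx : x ∈ Metric.closedBall (0 : Space) (L - t + 1)
    · rw [indicator_of_mem hx]
      exact hM (τ, x) ⟨hτ, hx⟩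
    · rw [indicator_of_notMem hx, pd_eq_zero_of_lt hu 0 (τ, x), norm_zero]
      rw [mem_closedBall_zero_iff, not_le] at hx
      have := hτ.1
      simp only
      linarith
  · exact (integrable_indicator_iff measurableSet_closedBall).2
      (integrableOn_const (isCompact_closedBall _ _).measure_lt_top.ne)
  · exact Eventually.of_forall fun x τ _ => hasDerivAt_time hc τ x

/-- The energy density `|∂_{t,x} v|²`, twice the usual one. -/
noncomputable def energyDensity (v : SpaceTime → ℝ) (p : SpaceTime) : ℝ := ∑ j : Fin 4, pd j v p ^ 2

theorem contDiff_energyDensity {v : SpaceTime → ℝ} (hv : ContDiff ℝ ∞ v) :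
    ContDiff ℝ ∞ (energyDensity v) := ContDiff.sum fun _ _ => (contDiff_pd hv _).pow 2

theorem energyDensity_nonneg (v : SpaceTime → ℝ) (p : SpaceTime) : 0 ≤ energyDensity v p :=
  Finset.sum_nonneg fun _ _ => sq_nonneg _

/-- A smooth weight that is `1` where `t + (1 + |x|²)^(1/2) ≤ L - 1` and `0` where
`t + (1 + |x|²)^(1/2) ≥ L`. Its gradient is causal and points to the past, which makes the boundary
terms of the weighted energy identity favourable. -/
noncomputable def cutoff (L : ℝ) (p : SpaceTime) : ℝ :=
  Real.smoothTransition (L - p.1 - Real.sqrt (1 + ‖p.2‖ ^ 2))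

theorem cutoff_nonneg (L : ℝ) (p : SpaceTime) : 0 ≤ cutoff L p := Real.smoothTransition.nonneg _

theorem cutoff_le_one (L : ℝ) (p : SpaceTime) : cutoff L p ≤ 1 := Real.smoothTransition.le_one _

theorem cutoff_eq_zero {L : ℝ} {p : SpaceTime} (hp : L < p.1 + ‖p.2‖) : cutoff L p = 0 := by
  refine Real.smoothTransition.zero_of_nonpos ?_
  have : ‖p.2‖ ≤ Real.sqrt (1 + ‖p.2‖ ^ 2) := Real.le_sqrt_of_sq_le (by linarith)
  linarith

theorem contDiff_sqrt_one_add_norm_sq :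
    ContDiff ℝ ∞ fun p : SpaceTime => Real.sqrt (1 + ‖p.2‖ ^ 2) :=
  (contDiff_const.add (contDiff_snd.norm_sq ℝ)).sqrt fun p => by positivity

theorem contDiff_cutoff (L : ℝ) : ContDiff ℝ ∞ (cutoff L) :=
  Real.smoothTransition.contDiff.comp
    ((contDiff_const.sub contDiff_fst).sub contDiff_sqrt_one_add_norm_sq)

/-- The gradient of the weight is `-c (1, x / (1 + |x|²)^(1/2))` with `c ≥ 0`. -/
theorem exists_pd_cutoff (L : ℝ) (p : SpaceTime) : ∃ c : ℝ, 0 ≤ c ∧ pd 0 (cutoff L) p = -c ∧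
    ∀ k : Fin 3, pd k.succ (cutoff L) p = -c * (p.2 k / Real.sqrt (1 + ‖p.2‖ ^ 2)) := by
  set s := Real.sqrt (1 + ‖p.2‖ ^ 2) with hs
  have h0 : (1 + ‖p.2‖ ^ 2) ≠ 0 := by positivity
  have h1 : HasFDerivAt (fun q : SpaceTime => 1 + ‖q.2‖ ^ 2)
      (2 • ((innerSL ℝ p.2).comp (ContinuousLinearMap.snd ℝ ℝ Space))) p :=
    ((hasFDerivAt_snd (𝕜 := ℝ) (p := p)).norm_sq).const_add 1
  have h2 := h1.sqrt h0
  have h3 : HasFDerivAt (fun q : SpaceTime => L - q.1) (-(ContinuousLinearMap.fst ℝ ℝ Space)) p :=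
    (hasFDerivAt_fst (𝕜 := ℝ) (p := p)).const_sub L
  have h4 := h3.sub h2
  have h5 : HasDerivAt Real.smoothTransition
      (deriv Real.smoothTransition (L - p.1 - s)) (L - p.1 - s) :=
    ((Real.smoothTransition.contDiff (n := ⊤)).differentiable (by simp) _).hasDerivAt
  have h6 : HasFDerivAt (cutoff L) _ p := h5.comp_hasFDerivAt p h4
  refine ⟨deriv Real.smoothTransition (L - p.1 - s),
    Real.smoothTransition.monotone.deriv_nonneg, ?_, fun k => ?_⟩
  · rw [pd, h6.fderiv]
    simp [basisVec]
  · rw [pd, h6.fderiv]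
    simp [basisVec, EuclideanSpace.inner_single_right]
    left
    rw [← hs]
    field_simp

/-- The energy identity in divergence form: up to a divergence, the time derivative of the weighted
energy density is at most `2 θ ∂_t v □v`. -/
theorem pd_zero_cutoff_mul_le {v : SpaceTime → ℝ} (hv : ContDiff ℝ ∞ v) (L : ℝ) (p : SpaceTime) :
    pd 0 (fun q => cutoff L q * energyDensity v q) p ≤
      2 * (cutoff L p * pd 0 v p * box v p) +
        ∑ k : Fin 3, 2 * pd k.succ (fun q => cutoff L q * (pd 0 v q * pd k.succ v q)) p := by
  have hθ := contDiff_cutoff L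
  have hd := contDiff_pd hv
  obtain ⟨c, hc, h0, hk⟩ := exists_pd_cutoff L p
  have e1 : pd 0 (energyDensity v) p = ∑ j, 2 * (pd j v p * pd 0 (pd j v) p) := by
    have : energyDensity v = fun q => ∑ j, pd j v q * pd j v q := by
      ext q; simp [energyDensity, sq]
    rw [this, pd_sum _ (fun j => (hd j).mul (hd j))]
    refine Finset.sum_congr rfl fun j _ => ?_
    rw [pd_mul (hd j) (hd j)]
    ring
  rw [pd_mul hθ (contDiff_energyDensity hv)]
  simp only [pd_mul hθ ((hd 0).mul (hd _)), pd_mul (hd 0) (hd _), e1, h0, hk]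
  have hcomm : ∀ k : Fin 3, pd k.succ (pd 0 v) p = pd 0 (pd k.succ v) p := fun k => by
    rw [pd_comm hv]
  simp only [hcomm, box, energyDensity, Fin.sum_univ_succ (n := 3)]
  set s := Real.sqrt (1 + ‖p.2‖ ^ 2) with hs
  have hs2 : s ^ 2 = 1 + ‖p.2‖ ^ 2 := Real.sq_sqrt (by positivity)
  have hs0 : 0 < s := Real.sqrt_pos.2 (by positivity)
  have hnorm : ‖p.2‖ ^ 2 = ∑ k, p.2 k ^ 2 := by
    rw [EuclideanSpace.norm_sq_eq]
    simp
  have key : 0 ≤ c * (pd 0 v p ^ 2 + ∑ k : Fin 3, (pd k.succ v p ^ 2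
      - 2 * (p.2 k / s) * (pd 0 v p * pd k.succ v p))) := by
    refine mul_nonneg hc ?_
    have e : ∑ k : Fin 3, (p.2 k / s) ^ 2 = ‖p.2‖ ^ 2 / s ^ 2 := by
      rw [hnorm, Finset.sum_div]
      simp [div_pow]
    have h1 : ‖p.2‖ ^ 2 / s ^ 2 ≤ 1 := by
      rw [div_le_one (by positivity)]
      linarith
    have h2 : 0 ≤ ∑ k : Fin 3, (pd k.succ v p - p.2 k / s * pd 0 v p) ^ 2 :=
      Finset.sum_nonneg fun _ _ => sq_nonneg _
    have h3 : ∑ k : Fin 3, (pd k.succ v p - p.2 k / s * pd 0 v p) ^ 2 =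
        ∑ k : Fin 3, (pd k.succ v p ^ 2 - 2 * (p.2 k / s) * (pd 0 v p * pd k.succ v p))
          + ‖p.2‖ ^ 2 / s ^ 2 * pd 0 v p ^ 2 := by
      rw [← e, Finset.sum_mul, ← Finset.sum_add_distrib]
      exact Finset.sum_congr rfl fun k _ => by ring
    nlinarith [mul_le_mul_of_nonneg_right h1 (sq_nonneg (pd 0 v p))]
  refine le_of_sub_nonneg (key.trans_eq ?_)
  simp only [Fin.sum_univ_three]
  ring

/-- The weighted energy identity integrated over space, where the divergence drops out, with the
source term split by the inequality between arithmetic and geometric means. -/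
theorem integral_pd_cutoff_mul_le {v : SpaceTime → ℝ} (hv : ContDiff ℝ ∞ v) (L t M : ℝ)
    (hM : sliceNorm (box v) t ≤ ENNReal.ofReal M) (hM0 : 0 ≤ M) (ε : ℝ) (hε : 0 < ε) :
    ∫ x : Space, pd 0 (fun q => cutoff L q * energyDensity v q) (t, x) ≤
      ε * (∫ x : Space, cutoff L (t, x) * energyDensity v (t, x)) + M ^ 2 / ε := by
  have hθ := contDiff_cutoff L
  have hd := contDiff_pd hv
  have hb := contDiff_box hv
  have he := contDiff_energyDensity hv
  have hz : ∀ (g : SpaceTime → ℝ) (p : SpaceTime), L < p.1 + ‖p.2‖ → cutoff L p * g p = 0 :=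
    fun g p hp => by rw [cutoff_eq_zero hp, zero_mul]
  have hflux : ∀ k : Fin 3, ContDiff ℝ ∞ (fun q => cutoff L q * (pd 0 v q * pd k.succ v q)) :=
    fun k => hθ.mul ((hd 0).mul (hd _))
  have i0 : Integrable fun x : Space => pd 0 (fun q => cutoff L q * energyDensity v q) (t, x) :=
    integrable_slice (contDiff_pd (hθ.mul he) 0).continuous (pd_eq_zero_of_lt (hz _) 0) t
  have i1 : Integrable fun x : Space => cutoff L (t, x) * energyDensity v (t, x) :=
    integrable_slice (u := fun q => cutoff L q * energyDensity v q) (hθ.mul he).continuous (hz _) t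
  have i2 : Integrable fun x : Space => cutoff L (t, x) * box v (t, x) ^ 2 :=
    integrable_slice (u := fun q => cutoff L q * box v q ^ 2) (hθ.mul (hb.pow 2)).continuous
      (hz _) t
  have i3 : ∀ k : Fin 3, Integrable fun x : Space =>
      2 * pd k.succ (fun q => cutoff L q * (pd 0 v q * pd k.succ v q)) (t, x) := fun k =>
    (integrable_slice (contDiff_pd (hflux k) _).continuous
      (pd_eq_zero_of_lt (hz fun q => pd 0 v q * pd k.succ v q) _) t).const_mul 2
  have hF : ∫ x : Space, cutoff L (t, x) * box v (t, x) ^ 2 ≤ M ^ 2 := by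
    have h0 : 0 ≤ᵐ[volume] fun x : Space => cutoff L (t, x) * box v (t, x) ^ 2 :=
      Eventually.of_forall fun x => mul_nonneg (cutoff_nonneg _ _) (sq_nonneg _)
    rw [← ENNReal.ofReal_le_ofReal_iff (sq_nonneg M), ofReal_integral_eq_lintegral_ofReal i2 h0]
    calc ∫⁻ x : Space, ENNReal.ofReal (cutoff L (t, x) * box v (t, x) ^ 2)
        ≤ ∫⁻ x : Space, ENNReal.ofReal (box v (t, x) ^ 2) :=
          lintegral_mono fun x => ENNReal.ofReal_le_ofReal
            (mul_le_of_le_one_left (sq_nonneg _) (cutoff_le_one _ _))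
      _ = sliceNorm (box v) t ^ 2 := (sliceNorm_sq _ _).symm
      _ ≤ ENNReal.ofReal M ^ 2 := by gcongr
      _ = ENNReal.ofReal (M ^ 2) := (ENNReal.ofReal_pow hM0 2).symm
  calc ∫ x : Space, pd 0 (fun q => cutoff L q * energyDensity v q) (t, x)
      ≤ ∫ x : Space, ((ε * (cutoff L (t, x) * energyDensity v (t, x))
          + cutoff L (t, x) * box v (t, x) ^ 2 * ε⁻¹) + ∑ k : Fin 3,
          2 * pd k.succ (fun q => cutoff L q * (pd 0 v q * pd k.succ v q)) (t, x)) := by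
        refine integral_mono i0 (((i1.const_mul ε).add (i2.mul_const _)).add
          (integrable_finsetSum _ fun k _ => i3 k)) fun x => ?_
        refine (pd_zero_cutoff_mul_le hv L (t, x)).trans (add_le_add_left ?_ _)
        have h1 : pd 0 v (t, x) ^ 2 ≤ energyDensity v (t, x) :=
          Finset.single_le_sum (f := fun j => pd j v (t, x) ^ 2) (fun _ _ => sq_nonneg _)
            (Finset.mem_univ 0)
        have h2 : 2 * (pd 0 v (t, x) * box v (t, x)) ≤
            ε * energyDensity v (t, x) + box v (t, x) ^ 2 * ε⁻¹ := by
          have h3 : 0 ≤ ε * (pd 0 v (t, x) - ε⁻¹ * box v (t, x)) ^ 2 := by positivity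
          have h4 : ε * (pd 0 v (t, x) - ε⁻¹ * box v (t, x)) ^ 2 = ε * pd 0 v (t, x) ^ 2
              - 2 * (pd 0 v (t, x) * box v (t, x)) + box v (t, x) ^ 2 * ε⁻¹ := by
            field_simp
            ring
          nlinarith [mul_le_mul_of_nonneg_left h1 hε.le]
        nlinarith [mul_le_mul_of_nonneg_left h2 (cutoff_nonneg L (t, x))]
    _ = ε * (∫ x : Space, cutoff L (t, x) * energyDensity v (t, x))
          + (∫ x : Space, cutoff L (t, x) * box v (t, x) ^ 2) * ε⁻¹ := by
        have i4 : Integrable fun x : Space => ε * (cutoff L (t, x) * energyDensity v (t, x))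
            + cutoff L (t, x) * box v (t, x) ^ 2 * ε⁻¹ := (i1.const_mul ε).add (i2.mul_const _)
        rw [integral_add i4 (integrable_finsetSum _ fun k _ => i3 k),
          integral_finsetSum _ fun k _ => i3 k, integral_add (i1.const_mul ε) (i2.mul_const _),
          integral_const_mul, integral_mul_const]
        have : ∀ k : Fin 3, ∫ x : Space,
            2 * pd k.succ (fun q => cutoff L q * (pd 0 v q * pd k.succ v q)) (t, x) = 0 :=
          fun k => by
            rw [integral_const_mul, integral_pd_succ_eq_zero (hflux k)
              (hz fun q => pd 0 v q * pd k.succ v q) t k, mul_zero]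
        simp [this]
    _ ≤ _ := by
        rw [div_eq_mul_inv]
        gcongr

/-- A Grönwall inequality for square roots. The hypothesis is the form that `E' ≤ 2 √E M` takes
after the inequality between arithmetic and geometric means. -/
theorem sqrt_le_sqrt_add_of_deriv_le {E E' : ℝ → ℝ} {a b M : ℝ} (hab : a ≤ b) (hM : 0 ≤ M)
    (hE : ∀ t, 0 ≤ E t) (hd : ∀ t, HasDerivAt E (E' t) t)
    (hb : ∀ t ∈ Icc a b, ∀ ε > 0, E' t ≤ ε * E t + M ^ 2 / ε) :
    √(E b) ≤ √(E a) + M * (b - a) := by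
  have main : ∀ δ > 0, √(E b + δ ^ 2) ≤ √(E a + δ ^ 2) + (M + δ) * (b - a) := by
    intro δ hδ
    have hpos : ∀ t, 0 < E t + δ ^ 2 := fun t => by have := hE t; positivity
    have hg : ∀ t, HasDerivAt (fun s => √(E s + δ ^ 2)) (E' t / (2 * √(E t + δ ^ 2))) t :=
      fun t => ((hd t).add_const _).sqrt (hpos t).ne'
    have := (convex_Icc a b).image_sub_le_mul_sub_of_deriv_le
      (f := fun s => √(E s + δ ^ 2)) (fun t _ => (hg t).continuousAt.continuousWithinAt)
      (fun t _ => (hg t).differentiableAt.differentiableWithinAt) (C := M + δ) (fun t ht => by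
        rw [(hg t).deriv, div_le_iff₀ (by have := hpos t; positivity)]
        have hsp : 0 < √(E t + δ ^ 2) := Real.sqrt_pos.2 (hpos t)
        have hss : √(E t + δ ^ 2) ^ 2 = E t + δ ^ 2 := Real.sq_sqrt (hpos t).le
        have hMd : 0 < M + δ := by linarith
        -- the choice of `ε` that balances the two terms
        have h := hb t (interior_subset ht) ((M + δ) / √(E t + δ ^ 2)) (by positivity)
        refine h.trans ?_
        rw [div_div_eq_mul_div]
        set s := √(E t + δ ^ 2)
        have h1 : (M + δ) / s * E t ≤ (M + δ) * s := by
          rw [div_mul_eq_mul_div, div_le_iff₀ hsp]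
          nlinarith [mul_pos hMd (pow_pos hδ 2)]
        have h2 : M ^ 2 * s / (M + δ) ≤ (M + δ) * s := by
          rw [div_le_iff₀ hMd]
          have : M ^ 2 ≤ (M + δ) ^ 2 := by gcongr; linarith
          nlinarith [mul_le_mul_of_nonneg_right this hsp.le]
        linarith) a (left_mem_Icc.2 hab) b (right_mem_Icc.2 hab) hab
    linarith
  have hl : Tendsto (fun δ : ℝ => √(E b + δ ^ 2)) (𝓝[>] 0) (𝓝 (√(E b))) := by
    have : Continuous fun δ : ℝ => √(E b + δ ^ 2) := by fun_prop
    simpa using (this.tendsto 0).mono_left nhdsWithin_le_nhds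
  have hr : Tendsto (fun δ : ℝ => √(E a + δ ^ 2) + (M + δ) * (b - a)) (𝓝[>] 0)
      (𝓝 (√(E a) + M * (b - a))) := by
    have : Continuous fun δ : ℝ => √(E a + δ ^ 2) + (M + δ) * (b - a) := by fun_prop
    simpa using (this.tendsto 0).mono_left nhdsWithin_le_nhds
  exact le_of_tendsto_of_tendsto hl hr (eventually_nhdsWithin_of_forall main)

theorem pd_eq_zero_of_initial {v : SpaceTime → ℝ} (hv : ContDiff ℝ ∞ v) {a : ℝ}
    (h0 : ∀ (t : ℝ) (x : Space), t ≤ a → v (t, x) = 0) (j : Fin 4) {t : ℝ} (ht : t ≤ a)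
    (x : Space) : pd j v (t, x) = 0 := by
  have hlt : ∀ τ < a, pd j v (τ, x) = 0 := fun τ hτ => by
    refine pd_eq_zero_of_eventually ?_ j
    filter_upwards [(continuous_fst.tendsto ((τ, x) : SpaceTime)).eventually_lt_const hτ]
      with q hq using h0 q.1 q.2 (le_of_lt hq)
  have hcl : IsClosed {τ : ℝ | pd j v (τ, x) = 0} := by
    have hc : Continuous fun τ : ℝ => pd j v (τ, x) := by
      have := (contDiff_pd hv j).continuous
      fun_prop
    exact isClosed_eq hc continuous_const
  have : Iic a ⊆ {τ : ℝ | pd j v (τ, x) = 0} := by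
    rw [← closure_Iio]
    exact hcl.closure_subset_iff.2 hlt
  exact this ht

/-! ### The energy inequality with a dyadic right-hand side -/

/-- The dyadic times `2 ^ k`, restricted to the interval `[a, T]`. -/
noncomputable def dyadicTime (a T : ℝ) (k : ℤ) : ℝ := max a (min T ((2 : ℝ) ^ k))

theorem dyadicTime_le_succ (a T : ℝ) (k : ℤ) : dyadicTime a T k ≤ dyadicTime a T (k + 1) := by
  have : (2 : ℝ) ^ k ≤ 2 ^ (k + 1) := zpow_le_zpow_right₀ (by norm_num) (by lia)
  unfold dyadicTime
  gcongr

theorem dyadicTime_bounds {a T : ℝ} {k : ℤ}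
    (h : dyadicTime a T k < dyadicTime a T (k + 1)) :
    (2 : ℝ) ^ k ≤ dyadicTime a T k ∧ dyadicTime a T (k + 1) ≤ 2 ^ (k + 1) := by
  have : (2 : ℝ) ^ k ≤ 2 ^ (k + 1) := zpow_le_zpow_right₀ (by norm_num) (by lia)
  unfold dyadicTime at *
  constructor
  · by_contra! h1
    rcases max_lt_iff.1 h1 with ⟨h2, h3⟩
    rcases min_lt_iff.1 h3 with h4 | h4
    · rw [min_eq_left h4.le, min_eq_left (h4.le.trans this)] at h
      exact lt_irrefl _ h
    · exact lt_irrefl _ h4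
  · by_contra! h1
    rcases lt_max_iff.1 h1 with h2 | h2
    · rw [max_eq_left ((min_le_right T _).trans h2.le)] at h
      exact absurd h (not_lt.2 (le_max_left _ _))
    · exact absurd h2 (not_lt.2 (min_le_right _ _))

/-- One summand of `dyadicSum`. -/
noncomputable def dyadicTerm (a t : ℝ) (g : SpaceTime → ℝ) (k : ℤ) : ℝ≥0∞ :=
  ⨆ τ ∈ Icc ((2 : ℝ) ^ (k - 1)) ((2 : ℝ) ^ (k + 1)) ∩ Icc a t,
    ENNReal.ofReal ((2 : ℝ) ^ k) * sliceNorm g τ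

theorem mul_sliceNorm_le_dyadicTerm {a t τ : ℝ} (g : SpaceTime → ℝ) {k : ℤ}
    (h1 : τ ∈ Icc ((2 : ℝ) ^ (k - 1)) ((2 : ℝ) ^ (k + 1))) (h2 : τ ∈ Icc a t) :
    ENNReal.ofReal ((2 : ℝ) ^ k) * sliceNorm g τ ≤ dyadicTerm a t g k :=
  le_iSup₂ (f := fun (τ : ℝ) (_ : τ ∈ Icc ((2 : ℝ) ^ (k - 1)) ((2 : ℝ) ^ (k + 1)) ∩ Icc a t) =>
    ENNReal.ofReal ((2 : ℝ) ^ k) * sliceNorm g τ) τ ⟨h1, h2⟩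

theorem dyadicTerm_le_dyadicSum (a t : ℝ) (g : SpaceTime → ℝ) (k : ℤ) :
    dyadicTerm a t g k ≤ dyadicSum a t g := ENNReal.le_tsum (f := dyadicTerm a t g) k

theorem ofReal_mul_sliceNorm_le {a t : ℝ} (ha : 0 < a) (hat : a ≤ t) (g : SpaceTime → ℝ) :
    ENNReal.ofReal t * sliceNorm g t ≤ 2 * dyadicSum a t g := by
  obtain ⟨k, hk1, hk2⟩ := exists_mem_Ico_zpow (x := t) (y := 2) (by linarith) (by norm_num)
  have h1 : (2 : ℝ) ^ (k - 1) ≤ 2 ^ k := zpow_le_zpow_right₀ (by norm_num) (by lia)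
  have h2 := (mul_sliceNorm_le_dyadicTerm g ⟨h1.trans hk1, hk2.le⟩ ⟨hat, le_rfl⟩).trans
    (dyadicTerm_le_dyadicSum a t g k)
  have h3 : ENNReal.ofReal t ≤ 2 * ENNReal.ofReal ((2 : ℝ) ^ k) := by
    rw [zpow_add₀ (by norm_num), zpow_one, mul_comm] at hk2
    calc ENNReal.ofReal t ≤ ENNReal.ofReal (2 * 2 ^ k) := ENNReal.ofReal_le_ofReal hk2.le
      _ = 2 * ENNReal.ofReal ((2 : ℝ) ^ k) := by
        rw [ENNReal.ofReal_mul (by norm_num), ENNReal.ofReal_ofNat]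
  calc ENNReal.ofReal t * sliceNorm g t ≤ 2 * ENNReal.ofReal ((2 : ℝ) ^ k) * sliceNorm g t := by
        gcongr
    _ ≤ 2 * dyadicSum a t g := by
        rw [mul_assoc]
        gcongr

/-- The integral over space of `energyDensity`, weighted by `cutoff`. -/
noncomputable def cutoffEnergy (L : ℝ) (v : SpaceTime → ℝ) (t : ℝ) : ℝ :=
  ∫ x : Space, cutoff L (t, x) * energyDensity v (t, x)

/-- The growth of the energy over one dyadic time interval, whose length is at most `2 ^ k`. -/
theorem sqrt_cutoffEnergy_succ_le {v : SpaceTime → ℝ} (hv : ContDiff ℝ ∞ v) (L : ℝ) {a T : ℝ}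
    (haT : a ≤ T) (k : ℤ) (hfin : dyadicTerm a T (box v) k ≠ ⊤) :
    √(cutoffEnergy L v (dyadicTime a T (k + 1))) ≤ √(cutoffEnergy L v (dyadicTime a T k)) +
      (dyadicTerm a T (box v) k).toReal := by
  rcases (dyadicTime_le_succ a T k).eq_or_lt with h | h
  · rw [h]
    exact le_add_of_nonneg_right ENNReal.toReal_nonneg
  obtain ⟨h1, h2⟩ := dyadicTime_bounds h
  set S := (dyadicTerm a T (box v) k).toReal with hS
  have hS0 : 0 ≤ S := ENNReal.toReal_nonneg
  have h2k : (0 : ℝ) < 2 ^ k := by positivity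
  have hsucc : (2 : ℝ) ^ (k + 1) = 2 ^ k * 2 := by rw [zpow_add₀ (by norm_num), zpow_one]
  have hpred : (2 : ℝ) ^ (k - 1) ≤ 2 ^ k := zpow_le_zpow_right₀ (by norm_num) (by lia)
  have hM : ∀ t ∈ Icc (dyadicTime a T k) (dyadicTime a T (k + 1)),
      sliceNorm (box v) t ≤ ENNReal.ofReal (S / 2 ^ k) := by
    intro t ht
    have ht2 : t ∈ Icc a T :=
      ⟨(le_max_left _ _).trans ht.1, ht.2.trans (max_le haT (min_le_left _ _))⟩
    have := mul_sliceNorm_le_dyadicTerm (box v) (k := k)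
      ⟨(hpred.trans h1).trans ht.1, ht.2.trans h2⟩ ht2
    rw [ENNReal.ofReal_div_of_pos h2k, hS, ENNReal.ofReal_toReal hfin]
    rw [ENNReal.le_div_iff_mul_le (Or.inl (by simpa using h2k)) (Or.inl ENNReal.ofReal_ne_top),
      mul_comm]
    exact this
  have hθe := (contDiff_cutoff L).mul (contDiff_energyDensity hv)
  have := sqrt_le_sqrt_add_of_deriv_le (E := cutoffEnergy L v) h.le (M := S / 2 ^ k)
    (by positivity)
    (fun t => integral_nonneg fun x => mul_nonneg (cutoff_nonneg _ _) (energyDensity_nonneg _ _))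
    (fun t => hasDerivAt_integral_slice (u := fun q => cutoff L q * energyDensity v q) hθe
      (fun p hp => by rw [cutoff_eq_zero hp, zero_mul]) t)
    (fun t ht ε hε => integral_pd_cutoff_mul_le hv L t (S / 2 ^ k) (hM t ht)
      (by positivity) ε hε)
  refine this.trans (add_le_add_right ?_ _)
  rw [div_mul_eq_mul_div, div_le_iff₀ h2k]
  gcongr
  linarith

theorem sqrt_cutoffEnergy_le {v : SpaceTime → ℝ} (hv : ContDiff ℝ ∞ v) (L : ℝ) {a T : ℝ}
    (ha : 0 < a) (haT : a ≤ T) (h0 : ∀ (t : ℝ) (x : Space), t ≤ a → v (t, x) = 0)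
    (hfin : dyadicSum a T (box v) ≠ ⊤) :
    √(cutoffEnergy L v T) ≤ (dyadicSum a T (box v)).toReal := by
  have hterm : ∀ k, dyadicTerm a T (box v) k ≠ ⊤ := fun k =>
    ne_top_of_le_ne_top hfin (dyadicTerm_le_dyadicSum a T _ k)
  have hsum : ∀ (m : ℤ) (n : ℕ), √(cutoffEnergy L v (dyadicTime a T (m + n))) ≤
      √(cutoffEnergy L v (dyadicTime a T m)) +
        ∑ i ∈ Finset.range n, (dyadicTerm a T (box v) (m + i)).toReal := by
    intro m n
    induction n with
    | zero => simp
    | succ n ih =>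
      have := sqrt_cutoffEnergy_succ_le hv L haT (m + n) (hterm _)
      rw [Finset.sum_range_succ, Nat.cast_succ, ← add_assoc]
      linarith
  obtain ⟨m, hm, -⟩ := exists_mem_Ico_zpow (x := a) (y := (2 : ℝ)) ha (by norm_num)
  obtain ⟨l, -, hl⟩ := exists_mem_Ico_zpow (x := T) (y := (2 : ℝ)) (by linarith) (by norm_num)
  obtain ⟨n, hn⟩ : ∃ n : ℕ, l + 1 ≤ m + n := ⟨(l + 1 - m).toNat, by lia⟩
  have h1 : dyadicTime a T m = a := by
    rw [dyadicTime, max_eq_left ((min_le_right _ _).trans hm)]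
  have h2 : dyadicTime a T (m + n) = T := by
    have : (2 : ℝ) ^ (l + 1) ≤ 2 ^ (m + (n : ℤ)) := zpow_le_zpow_right₀ (by norm_num) hn
    rw [dyadicTime, min_eq_left (hl.le.trans this), max_eq_right haT]
  have h3 : cutoffEnergy L v a = 0 := by
    have : ∀ x : Space, energyDensity v (a, x) = 0 := fun x => by
      simp [energyDensity, pd_eq_zero_of_initial hv h0 _ le_rfl]
    simp [cutoffEnergy, this]
  have h4 := hsum m n
  rw [h1, h2, h3, Real.sqrt_zero, zero_add] at h4
  refine h4.trans ?_
  rw [← ENNReal.toReal_sum fun i _ => hterm _]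
  refine ENNReal.toReal_mono hfin ?_
  let e : ℕ ↪ ℤ := ⟨fun i => m + i, fun i j h => by simpa using h⟩
  have h5 := ENNReal.sum_le_tsum (f := dyadicTerm a T (box v)) ((Finset.range n).map e)
  rw [Finset.sum_map] at h5
  exact h5

/-- The energy inequality `‖∂v(T)‖₂ ≤ ∫ ‖□v(τ)‖₂ dτ`, with the integral replaced by the dyadic sum.
No decay of `v` at infinity is needed, since the weights `cutoff L` localize to backward cones and
exhaust space as `L → ∞`. -/
theorem sliceNorm_pd_le_dyadicSum {v : SpaceTime → ℝ} (hv : ContDiff ℝ ∞ v) {a T : ℝ}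
    (ha : 0 < a) (haT : a ≤ T) (h0 : ∀ (t : ℝ) (x : Space), t ≤ a → v (t, x) = 0) (j : Fin 4) :
    sliceNorm (pd j v) T ≤ dyadicSum a T (box v) := by
  by_cases hfin : dyadicSum a T (box v) = ⊤
  · rw [hfin]
    exact le_top
  set D := (dyadicSum a T (box v)).toReal with hD
  have hD0 : 0 ≤ D := ENNReal.toReal_nonneg
  have hce : Continuous (energyDensity v) := (contDiff_energyDensity hv).continuous
  have hball : ∀ n : ℕ, ∫⁻ x in Metric.closedBall (0 : Space) n,
      ENNReal.ofReal (energyDensity v (T, x)) ≤ ENNReal.ofReal (D ^ 2) := by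
    intro n
    set L : ℝ := T + n + 2
    have h1 : cutoffEnergy L v T ≤ D ^ 2 :=
      (Real.sqrt_le_left hD0).1 (sqrt_cutoffEnergy_le hv L ha haT h0 hfin)
    have hint : Integrable fun x : Space => cutoff L (T, x) * energyDensity v (T, x) :=
      integrable_slice (u := fun q => cutoff L q * energyDensity v q)
        ((contDiff_cutoff L).continuous.mul hce)
        (fun p hp => by rw [cutoff_eq_zero hp, zero_mul]) T
    have h2 : ENNReal.ofReal (cutoffEnergy L v T) =
        ∫⁻ x : Space, ENNReal.ofReal (cutoff L (T, x) * energyDensity v (T, x)) :=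
      ofReal_integral_eq_lintegral_ofReal hint (Eventually.of_forall fun x =>
        mul_nonneg (cutoff_nonneg _ _) (energyDensity_nonneg _ _))
    calc ∫⁻ x in Metric.closedBall (0 : Space) n, ENNReal.ofReal (energyDensity v (T, x))
        = ∫⁻ x in Metric.closedBall (0 : Space) n,
            ENNReal.ofReal (cutoff L (T, x) * energyDensity v (T, x)) := by
          refine setLIntegral_congr_fun measurableSet_closedBall fun x hx => ?_
          have hx' : ‖x‖ ≤ n := by simpa using hx
          have hs : √(1 + ‖x‖ ^ 2) ≤ 1 + n := by
            refine Real.sqrt_le_iff.2 ⟨by positivity, ?_⟩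
            nlinarith [norm_nonneg x]
          have : cutoff L (T, x) = 1 := by
            refine Real.smoothTransition.one_of_one_le ?_
            simp only [L]
            linarith
          simp only [this, one_mul]
      _ ≤ ∫⁻ x : Space, ENNReal.ofReal (cutoff L (T, x) * energyDensity v (T, x)) :=
          setLIntegral_le_lintegral _ _
      _ ≤ ENNReal.ofReal (D ^ 2) := by
          rw [← h2]
          exact ENNReal.ofReal_le_ofReal h1
  have hm : AEMeasurable (fun x : Space => ENNReal.ofReal (energyDensity v (T, x))) := by
    have : Continuous fun x : Space => energyDensity v (T, x) := by fun_prop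
    exact this.measurable.ennreal_ofReal.aemeasurable
  have hall : ∫⁻ x : Space, ENNReal.ofReal (energyDensity v (T, x)) ≤ ENNReal.ofReal (D ^ 2) :=
    le_of_tendsto' ((aecover_closedBall (μ := (volume : Measure Space)) (x := 0)
      tendsto_natCast_atTop_atTop).lintegral_tendsto_of_countably_generated hm) hball
  rw [← ENNReal.pow_le_pow_left_iff (n := 2) (by norm_num), sliceNorm_sq]
  calc ∫⁻ x : Space, ENNReal.ofReal (pd j v (T, x) ^ 2)
      ≤ ∫⁻ x : Space, ENNReal.ofReal (energyDensity v (T, x)) :=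
        lintegral_mono fun x => ENNReal.ofReal_le_ofReal
          (Finset.single_le_sum (f := fun j => pd j v (T, x) ^ 2) (fun _ _ => sq_nonneg _)
            (Finset.mem_univ j))
    _ ≤ ENNReal.ofReal (D ^ 2) := hall
    _ = dyadicSum a T (box v) ^ 2 := by
        rw [ENNReal.ofReal_pow hD0, hD, ENNReal.ofReal_toReal hfin]

/-! ### A local Sobolev inequality -/

/-- Hardy's inequality for radial functions in three dimensions, without a condition at the
origin. -/
theorem integral_sq_le_four_mul {u u' : ℝ → ℝ} {R : ℝ} (hR : 0 < R)
    (hu : ∀ s ∈ Icc 0 R, HasDerivAt u (u' s) s) (hc : ContinuousOn u' (Icc 0 R)) (hz : u R = 0) :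
    ∫ s in (0 : ℝ)..R, u s ^ 2 ≤ 4 * ∫ s in (0 : ℝ)..R, s ^ 2 * u' s ^ 2 := by
  have hcu : ContinuousOn u (Icc 0 R) := fun s hs => (hu s hs).continuousAt.continuousWithinAt
  have hd : ∀ s ∈ uIcc 0 R, HasDerivAt (fun s => s * u s ^ 2) (u s ^ 2 + 2 * s * u s * u' s) s := by
    intro s hs
    rw [uIcc_of_le hR.le] at hs
    have := (hasDerivAt_id s).mul ((hu s hs).pow 2)
    refine this.congr_deriv ?_
    simp
    ring
  have hi : ∀ {f : ℝ → ℝ}, ContinuousOn f (Icc 0 R) → IntervalIntegrable f volume 0 R :=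
    fun hf => ContinuousOn.intervalIntegrable (by rwa [uIcc_of_le hR.le])
  have i1 : IntervalIntegrable (fun s => u s ^ 2 + 2 * s * u s * u' s) volume 0 R :=
    hi (by fun_prop)
  have i2 : IntervalIntegrable (fun s => u s ^ 2) volume 0 R := hi (by fun_prop)
  have i3 : IntervalIntegrable (fun s => s ^ 2 * u' s ^ 2) volume 0 R := hi (by fun_prop)
  have hftc := intervalIntegral.integral_eq_sub_of_hasDerivAt hd i1
  have hle : ∫ s in (0 : ℝ)..R, u s ^ 2 ≤
      ∫ s in (0 : ℝ)..R, (2 * (u s ^ 2 + 2 * s * u s * u' s) + 4 * (s ^ 2 * u' s ^ 2)) :=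
    intervalIntegral.integral_mono_on hR.le i2 ((i1.const_mul 2).add (i3.const_mul 4))
      fun s _ => by nlinarith [sq_nonneg (u s + 2 * s * u' s)]
  rw [intervalIntegral.integral_add (i1.const_mul 2) (i3.const_mul 4),
    intervalIntegral.integral_const_mul, intervalIntegral.integral_const_mul, hftc, hz] at hle
  simpa using hle

/-- The algebra behind the cutoff in `sq_le_mul_integral_ray`, with `r` the inverse radius and
`a`, `b`, `c` the values of a function and of its first two derivatives. -/
theorem cutoff_derivatives_sq_le (a b c : ℝ) {q r κ : ℝ} (hq0 : 0 ≤ q) (hq1 : q ≤ 1)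
    (hκ : 48 * r ^ 2 ≤ κ) :
    (q ^ 2 * b - 2 * r * q * a) ^ 2 + (q ^ 2 * c - 4 * r * q * b + 2 * r ^ 2 * a) ^ 2 ≤
      (8 + κ) * (a ^ 2 * r ^ 2 + b ^ 2 + c ^ 2) := by
  have two : ∀ x y : ℝ, (x - y) ^ 2 ≤ 2 * (x ^ 2 + y ^ 2) := fun x y => by
    nlinarith [sq_nonneg (x + y)]
  have three : ∀ x y z : ℝ, (x - y + z) ^ 2 ≤ 3 * (x ^ 2 + y ^ 2 + z ^ 2) := fun x y z => by
    nlinarith [sq_nonneg (x + y), sq_nonneg (x - z), sq_nonneg (y + z)]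
  have hq2 : q ^ 2 ≤ 1 := pow_le_one₀ hq0 hq1
  have hq4 : (q ^ 2) ^ 2 ≤ 1 := pow_le_one₀ (sq_nonneg q) hq2
  have e1 := two (q ^ 2 * b) (2 * r * q * a)
  have e2 := three (q ^ 2 * c) (4 * r * q * b) (2 * r ^ 2 * a)
  have f1 := mul_le_mul_of_nonneg_right hq4 (sq_nonneg b)
  have f2 := mul_le_mul_of_nonneg_right hq2 (sq_nonneg (r * a))
  have f3 := mul_le_mul_of_nonneg_right hq4 (sq_nonneg c)
  have f4 := mul_le_mul_of_nonneg_right hq2 (sq_nonneg (r * b))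
  have g1 := mul_le_mul_of_nonneg_right hκ (sq_nonneg b)
  have g2 := mul_le_mul_of_nonneg_right hκ (sq_nonneg (r * a))
  have g3 := mul_le_mul_of_nonneg_right hκ (sq_nonneg c)
  have p1 : 0 ≤ (r * a) ^ 2 := sq_nonneg _
  have p2 : 0 ≤ (r * c) ^ 2 := sq_nonneg _
  have p3 : 0 ≤ (r ^ 2 * a) ^ 2 := sq_nonneg _
  have p4 : 0 ≤ b ^ 2 := sq_nonneg _
  have p5 : 0 ≤ c ^ 2 := sq_nonneg _
  linarith

/-- The one-dimensional core of the local Sobolev inequality: the weight `s²` of polar coordinates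
is absorbed by two derivatives. -/
theorem sq_le_mul_integral_ray {h h' h'' : ℝ → ℝ} {R R₀ : ℝ} (hR₀ : 0 < R₀) (hR : R₀ ≤ R)
    (h1 : ∀ s ∈ Icc 0 R, HasDerivAt h (h' s) s) (h2 : ∀ s ∈ Icc 0 R, HasDerivAt h' (h'' s) s)
    (hc : ContinuousOn h'' (Icc 0 R)) :
    h 0 ^ 2 ≤ (32 + 192 / R₀ ^ 2) *
      ∫ s in (0 : ℝ)..R, s ^ 2 * (h s ^ 2 / R ^ 2 + h' s ^ 2 + h'' s ^ 2) := by
  have hRp : 0 < R := hR₀.trans_le hR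
  have hch : ContinuousOn h (Icc 0 R) := fun s hs => (h1 s hs).continuousAt.continuousWithinAt
  have hch' : ContinuousOn h' (Icc 0 R) := fun s hs => (h2 s hs).continuousAt.continuousWithinAt
  -- a cutoff that vanishes to second order at `R`
  let u : ℝ → ℝ := fun s => (1 - s / R) ^ 2 * h s
  let u' : ℝ → ℝ := fun s => (1 - s / R) ^ 2 * h' s - 2 / R * (1 - s / R) * h s
  let u'' : ℝ → ℝ := fun s => (1 - s / R) ^ 2 * h'' s - 4 / R * (1 - s / R) * h' s + 2 / R ^ 2 * h s
  have hl : ∀ s, HasDerivAt (fun s : ℝ => 1 - s / R) (-(1 / R)) s := fun s =>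
    ((hasDerivAt_id s).div_const R).const_sub 1
  have hu : ∀ s ∈ Icc 0 R, HasDerivAt u (u' s) s := fun s hs => by
    refine (((hl s).pow 2).mul (h1 s hs)).congr_deriv ?_
    simp [u']
    ring
  have hu' : ∀ s ∈ Icc 0 R, HasDerivAt u' (u'' s) s := fun s hs => by
    refine ((((hl s).pow 2).mul (h2 s hs)).sub (((hl s).const_mul (2 / R)).mul
      (h1 s hs))).congr_deriv ?_
    simp [u'']
    ring
  have hcu : ContinuousOn u (Icc 0 R) := fun s hs => (hu s hs).continuousAt.continuousWithinAt
  have hcu' : ContinuousOn u' (Icc 0 R) := fun s hs => (hu' s hs).continuousAt.continuousWithinAt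
  have hcu'' : ContinuousOn u'' (Icc 0 R) := by fun_prop
  have hi : ∀ {f : ℝ → ℝ}, ContinuousOn f (Icc 0 R) → IntervalIntegrable f volume 0 R :=
    fun hf => ContinuousOn.intervalIntegrable (by rwa [uIcc_of_le hRp.le])
  have i1 : IntervalIntegrable (fun s => u s ^ 2) volume 0 R := hi (by fun_prop)
  have i2 : IntervalIntegrable (fun s => u' s ^ 2) volume 0 R := hi (by fun_prop)
  have i3 : IntervalIntegrable (fun s => 2 * u s * u' s) volume 0 R := hi (by fun_prop)
  have i4 : IntervalIntegrable (fun s => s ^ 2 * u' s ^ 2) volume 0 R := hi (by fun_prop)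
  have i5 : IntervalIntegrable (fun s => s ^ 2 * u'' s ^ 2) volume 0 R := hi (by fun_prop)
  have i6 : IntervalIntegrable (fun s => s ^ 2 * (h s ^ 2 / R ^ 2 + h' s ^ 2 + h'' s ^ 2))
    volume 0 R := hi (by fun_prop)
  have huR : u R = 0 := by simp [u, hRp.ne']
  have huR' : u' R = 0 := by simp [u', hRp.ne']
  have hu0 : u 0 = h 0 := by simp [u]
  have hftc := intervalIntegral.integral_eq_sub_of_hasDerivAt (f := fun s => u s ^ 2)
    (f' := fun s => 2 * u s * u' s) (a := 0) (b := R) (fun s hs => by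
      rw [uIcc_of_le hRp.le] at hs
      refine ((hu s hs).pow 2).congr_deriv ?_
      simp) i3
  rw [huR, hu0] at hftc
  have hA : h 0 ^ 2 ≤ (∫ s in (0 : ℝ)..R, u s ^ 2) + ∫ s in (0 : ℝ)..R, u' s ^ 2 := by
    rw [← intervalIntegral.integral_add i1 i2]
    have : -(∫ s in (0 : ℝ)..R, 2 * u s * u' s) ≤ ∫ s in (0 : ℝ)..R, (u s ^ 2 + u' s ^ 2) := by
      rw [← intervalIntegral.integral_neg]
      exact intervalIntegral.integral_mono_on hRp.le i3.neg (i1.add i2)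
        fun s _ => by nlinarith [sq_nonneg (u s + u' s)]
    nlinarith
  have hB := integral_sq_le_four_mul hRp hu hcu' huR
  have hC := integral_sq_le_four_mul hRp hu' hcu'' huR'
  have hD : (∫ s in (0 : ℝ)..R, s ^ 2 * u' s ^ 2) + (∫ s in (0 : ℝ)..R, s ^ 2 * u'' s ^ 2) ≤
      (8 + 48 / R₀ ^ 2) * ∫ s in (0 : ℝ)..R, s ^ 2 * (h s ^ 2 / R ^ 2 + h' s ^ 2 + h'' s ^ 2) := by
    rw [← intervalIntegral.integral_add i4 i5, ← intervalIntegral.integral_const_mul]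
    refine intervalIntegral.integral_mono_on hRp.le (i4.add i5) (i6.const_mul _) fun s hs => ?_
    rw [← mul_add, mul_left_comm]
    refine mul_le_mul_of_nonneg_left ?_ (sq_nonneg s)
    have hq0 : 0 ≤ 1 - s / R := by rw [sub_nonneg, div_le_one hRp]; exact hs.2
    have hq1 : 1 - s / R ≤ 1 := by linarith [div_nonneg hs.1 hRp.le]
    have hρ : 48 * (1 / R) ^ 2 ≤ 48 / R₀ ^ 2 := by
      calc 48 * (1 / R) ^ 2 = 48 / R ^ 2 := by ring
        _ ≤ 48 / R₀ ^ 2 := by gcongr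
    refine le_trans (le_of_eq ?_) ((cutoff_derivatives_sq_le (h s) (h' s) (h'' s) hq0 hq1 hρ).trans
      (le_of_eq ?_))
    · simp only [u', u'']
      ring
    · ring
  calc h 0 ^ 2 ≤ 4 * ((∫ s in (0 : ℝ)..R, s ^ 2 * u' s ^ 2)
        + (∫ s in (0 : ℝ)..R, s ^ 2 * u'' s ^ 2)) := by linarith
    _ ≤ 4 * ((8 + 48 / R₀ ^ 2) *
        ∫ s in (0 : ℝ)..R, s ^ 2 * (h s ^ 2 / R ^ 2 + h' s ^ 2 + h'' s ^ 2)) := by gcongr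
    _ = _ := by ring

/-- Integration in polar coordinates. -/
theorem lintegral_polar {f : Space → ℝ≥0∞} (hf : Measurable f) :
    ∫⁻ x : Space, f x = ∫⁻ ξ : Metric.sphere (0 : Space) 1, (∫⁻ s in Ioi (0 : ℝ),
      ENNReal.ofReal (s ^ 2) * f (s • (ξ : Space))) ∂(volume : Measure Space).toSphere := by
  have hmp := (volume : Measure Space).measurePreserving_homeomorphUnitSphereProd
  have hd : Module.finrank ℝ Space - 1 = 2 := by simp
  rw [hd] at hmp
  have hg : Measurable fun p : Metric.sphere (0 : Space) 1 × Ioi (0 : ℝ) =>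
      f ((p.2 : ℝ) • (p.1 : Space)) := by fun_prop
  have h1 := hmp.lintegral_comp hg
  have h2 : ∀ x : ({0}ᶜ : Set Space), f (((homeomorphUnitSphereProd Space x).2 : ℝ) •
      ((homeomorphUnitSphereProd Space x).1 : Space)) = f x := fun x => by
    have hx : ‖(x : Space)‖ ≠ 0 := norm_ne_zero_iff.2 x.2
    simp [smul_smul, hx]
  simp only [h2] at h1
  rw [lintegral_subtype_comap (measurableSet_singleton (0 : Space)).compl f,
    restrict_compl_singleton] at h1
  rw [h1, lintegral_prod _ hg.aemeasurable]
  refine lintegral_congr fun ξ => ?_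
  rw [Measure.volumeIoiPow, lintegral_withDensity_eq_lintegral_mul _ (by fun_prop) (by fun_prop)]
  exact lintegral_subtype_comap measurableSet_Ioi
    (fun s : ℝ => ENNReal.ofReal (s ^ 2) * f (s • (ξ : Space)))

/-- The spatial partial derivative `∂_k`. -/
noncomputable def spd (k : Fin 3) (g : Space → ℝ) (x : Space) : ℝ :=
  fderiv ℝ g x (EuclideanSpace.single k 1)

theorem measurable_spd (k : Fin 3) (g : Space → ℝ) : Measurable (spd k g) :=
  measurable_fderiv_apply_const ℝ g _

theorem contDiffOn_spd {g : Space → ℝ} {U : Set Space} (hU : IsOpen U) (hg : ContDiffOn ℝ ∞ g U)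
    (k : Fin 3) : ContDiffOn ℝ ∞ (spd k g) U :=
  (hg.fderiv_of_isOpen hU (m := ∞) (by simp)).clm_apply contDiffOn_const

theorem hasDerivAt_ray {g : Space → ℝ} {U : Set Space} (hU : IsOpen U) (hg : ContDiffOn ℝ ∞ g U)
    {X ξ : Space} {s : ℝ} (hs : X + s • ξ ∈ U) :
    HasDerivAt (fun s : ℝ => g (X + s • ξ)) (∑ k, ξ k * spd k g (X + s • ξ)) s := by
  have h1 : DifferentiableAt ℝ g (X + s • ξ) :=
    (hg.differentiableOn (by simp)).differentiableAt (hU.mem_nhds hs)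
  have h2 : HasDerivAt (fun s : ℝ => X + s • ξ) ξ s := by
    simpa using ((hasDerivAt_id s).smul_const ξ).const_add X
  refine (h1.hasFDerivAt.comp_hasDerivAt s h2).congr_deriv ?_
  have hξ : ξ = ∑ k, ξ k • EuclideanSpace.single k (1 : ℝ) := by
    ext i
    simp [Pi.single_apply]
  calc fderiv ℝ g (X + s • ξ) ξ
      = fderiv ℝ g (X + s • ξ) (∑ k, ξ k • EuclideanSpace.single k (1 : ℝ)) := by rw [← hξ]
    _ = ∑ k, ξ k * spd k g (X + s • ξ) := by simp [spd]

/-- The sum of the squares of the derivatives of order at most two, the function itself being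
weighted by the inverse of the radius `R`. -/
noncomputable def sobolevDensity (R : ℝ) (g : Space → ℝ) (x : Space) : ℝ :=
  g x ^ 2 / R ^ 2 + ∑ k, spd k g x ^ 2 + ∑ k, ∑ l, spd l (spd k g) x ^ 2

theorem measurable_sobolevDensity (R : ℝ) {g : Space → ℝ} (hg : Measurable g) :
    Measurable (sobolevDensity R g) := by
  have h1 := fun k => measurable_spd k g
  have h2 := fun k l => measurable_spd l (spd k g)
  unfold sobolevDensity
  fun_prop

theorem sobolevDensity_nonneg (R : ℝ) (g : Space → ℝ) (x : Space) :
    0 ≤ sobolevDensity R g x := by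
  unfold sobolevDensity
  positivity

/-- A local Sobolev inequality on balls of radius bounded below. -/
theorem exists_local_sobolev {R₀ : ℝ} (hR₀ : 0 < R₀) : ∃ K : ℝ≥0, ∀ (U : Set Space) (g : Space → ℝ)
    (X : Space) (R : ℝ), IsOpen U → ContDiffOn ℝ ∞ g U → Measurable g → R₀ ≤ R →
      Metric.closedBall X R ⊆ U →
      ENNReal.ofReal (g X ^ 2) ≤
        K * ∫⁻ x in Metric.closedBall X R, ENNReal.ofReal (sobolevDensity R g x) := by
  set m := (volume : Measure Space).toSphere univ with hm
  have hm0 : m ≠ 0 := by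
    rw [hm, Ne, Measure.measure_univ_eq_zero]
    exact Measure.toSphere_ne_zero _
  have hmt : m ≠ ⊤ := measure_ne_top _ _
  set A : ℝ := 32 + 192 / R₀ ^ 2 with hA
  have hA0 : 0 ≤ A := by positivity
  refine ⟨(ENNReal.ofReal A / m).toNNReal, fun U g X R hU hg hgm hR hball => ?_⟩
  have hRp : 0 < R := hR₀.trans_le hR
  rw [ENNReal.coe_toNNReal (ENNReal.div_ne_top ENNReal.ofReal_ne_top hm0)]
  set Q := sobolevDensity R g with hQ
  have hQm : Measurable Q := measurable_sobolevDensity R hgm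
  set f : Space → ℝ≥0∞ := (Metric.closedBall (0 : Space) R).indicator
    fun y => ENNReal.ofReal (Q (X + y)) with hf
  have hfm : Measurable f := by
    refine Measurable.indicator ?_ measurableSet_closedBall
    exact (hQm.comp (measurable_const_add X)).ennreal_ofReal
  have e1 : ∫⁻ x in Metric.closedBall X R, ENNReal.ofReal (Q x) = ∫⁻ y : Space, f y := by
    rw [← lintegral_indicator measurableSet_closedBall, ← lintegral_add_left_eq_self _ X]
    refine lintegral_congr fun y => ?_
    simp only [hf, indicator, Metric.mem_closedBall, dist_self_add_left, dist_zero_right]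
  have key : ∀ ξ : Metric.sphere (0 : Space) 1, ENNReal.ofReal (g X ^ 2) ≤
      ENNReal.ofReal A * ∫⁻ s in Ioi (0 : ℝ), ENNReal.ofReal (s ^ 2) * f (s • (ξ : Space)) := by
    intro ξ
    have hξ : ‖(ξ : Space)‖ = 1 := by simp
    have hξ2 : ∑ k, (ξ : Space) k ^ 2 = 1 := by
      have := EuclideanSpace.norm_sq_eq (ξ : Space)
      rw [hξ] at this
      simpa using this.symm
    have hmem : ∀ s ∈ Icc 0 R, X + s • (ξ : Space) ∈ U := fun s hs => hball (by
      simp [norm_smul, hξ, abs_of_nonneg hs.1, hs.2])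
    set h : ℝ → ℝ := fun s => g (X + s • (ξ : Space)) with hh
    set h' : ℝ → ℝ := fun s => ∑ k, (ξ : Space) k * spd k g (X + s • (ξ : Space)) with hh'
    set h'' : ℝ → ℝ := fun s => ∑ k, (ξ : Space) k *
      ∑ l, (ξ : Space) l * spd l (spd k g) (X + s • (ξ : Space)) with hh''
    have hcont : ∀ {φ : Space → ℝ}, ContDiffOn ℝ ∞ φ U →
        ContinuousOn (fun s : ℝ => φ (X + s • (ξ : Space))) (Icc 0 R) := fun hφ =>
      hφ.continuousOn.comp (by fun_prop) hmem
    have hcg := hcont hg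
    have hc1 := fun k => hcont (contDiffOn_spd hU hg k)
    have hc2 := fun k l => hcont (contDiffOn_spd hU (contDiffOn_spd hU hg k) l)
    have hQc : ContinuousOn (fun s : ℝ => Q (X + s • (ξ : Space))) (Icc 0 R) := by
      exact (((hcg.pow 2).div_const _).add (continuousOn_finsetSum _ fun k _ =>
        (hc1 k).pow 2)).add (continuousOn_finsetSum _ fun k _ =>
          continuousOn_finsetSum _ fun l _ => (hc2 k l).pow 2)
    have h1 := sq_le_mul_integral_ray (h := h) (h' := h') (h'' := h'') hR₀ hR
      (fun s hs => hasDerivAt_ray hU hg (hmem s hs))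
      (fun s hs => HasDerivAt.fun_sum fun k _ =>
        (hasDerivAt_ray hU (contDiffOn_spd hU hg k) (hmem s hs)).const_mul _)
      (by simp only [hh'']; fun_prop)
    have hpt : ∀ s, h s ^ 2 / R ^ 2 + h' s ^ 2 + h'' s ^ 2 ≤ Q (X + s • (ξ : Space)) := by
      intro s
      have cs : ∀ b : Fin 3 → ℝ, (∑ k, (ξ : Space) k * b k) ^ 2 ≤ ∑ k, b k ^ 2 := fun b => by
        have := Finset.sum_mul_sq_le_sq_mul_sq Finset.univ (fun k => (ξ : Space) k) b
        rwa [hξ2, one_mul] at this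
      have a1 := cs fun k => spd k g (X + s • (ξ : Space))
      have a2 := (cs fun k => ∑ l, (ξ : Space) l * spd l (spd k g) (X + s • (ξ : Space))).trans
        (Finset.sum_le_sum fun k _ => cs fun l => spd l (spd k g) (X + s • (ξ : Space)))
      exact add_le_add (add_le_add le_rfl a1) a2
    have i1 : IntegrableOn (fun s : ℝ => s ^ 2 * Q (X + s • (ξ : Space))) (Ioc 0 R) := by
      have : ContinuousOn (fun s : ℝ => s ^ 2 * Q (X + s • (ξ : Space))) (Icc 0 R) :=
        (continuousOn_id.pow 2).mul hQc
      exact (this.integrableOn_compact isCompact_Icc).mono_set Ioc_subset_Icc_self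
    have h2 : g X ^ 2 ≤ A * ∫ s in Ioc 0 R, s ^ 2 * Q (X + s • (ξ : Space)) := by
      have h0 : h 0 = g X := by simp [hh]
      rw [h0, intervalIntegral.integral_of_le hRp.le] at h1
      refine h1.trans (mul_le_mul_of_nonneg_left ?_ hA0)
      refine integral_mono_of_nonneg (Eventually.of_forall fun s => by positivity) i1
        (Eventually.of_forall fun s => mul_le_mul_of_nonneg_left (hpt s) (sq_nonneg s))
    calc ENNReal.ofReal (g X ^ 2)
        ≤ ENNReal.ofReal (A * ∫ s in Ioc 0 R, s ^ 2 * Q (X + s • (ξ : Space))) :=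
          ENNReal.ofReal_le_ofReal h2
      _ = ENNReal.ofReal A *
            ∫⁻ s in Ioc 0 R, ENNReal.ofReal (s ^ 2 * Q (X + s • (ξ : Space))) := by
          rw [ENNReal.ofReal_mul hA0, ofReal_integral_eq_lintegral_ofReal i1
            (Eventually.of_forall fun s => mul_nonneg (sq_nonneg s) (sobolevDensity_nonneg _ _ _))]
      _ = ENNReal.ofReal A *
            ∫⁻ s in Ioc 0 R, ENNReal.ofReal (s ^ 2) * f (s • (ξ : Space)) := by
          congr 1
          refine setLIntegral_congr_fun measurableSet_Ioc fun s hs => ?_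
          have : s • (ξ : Space) ∈ Metric.closedBall (0 : Space) R := by
            simp [norm_smul, hξ, abs_of_nonneg hs.1.le, hs.2]
          simp only [hf, indicator_of_mem this, ENNReal.ofReal_mul (sq_nonneg s)]
      _ ≤ _ := by
          gcongr
          exact Ioc_subset_Ioi_self
  have hint := lintegral_mono (μ := (volume : Measure Space).toSphere) key
  rw [lintegral_const, lintegral_const_mul' _ _ ENNReal.ofReal_ne_top, ← lintegral_polar hfm,
    ← hm, ← e1] at hint
  rw [← ENNReal.mul_div_right_comm, ENNReal.le_div_iff_mul_le (Or.inl hm0) (Or.inl hmt)]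
  exact hint

/-! ### Square-integrability of the products of vector fields -/

theorem aestronglyMeasurable_slice {f : SpaceTime → ℝ} (hf : ContDiff ℝ ∞ f) (T : ℝ) :
    AEStronglyMeasurable (fun x : Space => f (T, x)) volume := by
  have := hf.continuous
  exact Continuous.aestronglyMeasurable (by fun_prop)

theorem sliceNorm_add_le {f g : SpaceTime → ℝ} (hf : ContDiff ℝ ∞ f) (hg : ContDiff ℝ ∞ g)
    (T : ℝ) : sliceNorm (fun p => f p + g p) T ≤ sliceNorm f T + sliceNorm g T :=
  eLpNorm_add_le (aestronglyMeasurable_slice hf T) (aestronglyMeasurable_slice hg T) (by norm_num)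

theorem sliceNorm_const_mul_le {c : ℝ} (hc : |c| ≤ 1) (f : SpaceTime → ℝ) (T : ℝ) :
    sliceNorm (fun p => c * f p) T ≤ sliceNorm f T :=
  eLpNorm_mono fun x => by
    rw [norm_mul]
    exact mul_le_of_le_one_left (norm_nonneg _) hc

theorem sliceNorm_sum_le {ι : Type*} [Fintype ι] {f : ι → SpaceTime → ℝ}
    (hf : ∀ m, ContDiff ℝ ∞ (f m)) {c : ι → ℝ} (hc : ∀ m, |c m| ≤ 1) (T : ℝ) :
    sliceNorm (fun p => ∑ m, c m * f m p) T ≤ ∑ m, sliceNorm (f m) T := by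
  have h := eLpNorm_sum_le (s := Finset.univ) (μ := (volume : Measure Space)) (p := 2)
    (f := fun m (x : Space) => c m * f m (T, x))
    (fun m _ => aestronglyMeasurable_slice (contDiff_const.mul (hf m)) T) (by norm_num)
  have e : (∑ m, fun x : Space => c m * f m (T, x)) = fun x => ∑ m, c m * f m (T, x) := by
    ext x
    simp
  rw [e] at h
  exact h.trans (Finset.sum_le_sum fun m _ => sliceNorm_const_mul_le (hc m) (f m) T)

/-- Moving a field `Γ` past a translation costs a constant factor. -/
theorem sliceNorm_Gamma_pd_le {v : SpaceTime → ℝ} (hv : ContDiff ℝ ∞ v) {T : ℝ} {A : ℝ≥0∞}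
    (a : GammaIndex) (h0 : ∀ m, sliceNorm (pd m v) T ≤ A)
    (h1 : ∀ m, sliceNorm (pd m (Gamma a v)) T ≤ A) (j : Fin 4) :
    sliceNorm (Gamma a (pd j v)) T ≤ 5 * A := by
  obtain ⟨c, hc, h⟩ := exists_Gamma_pd a j
  rw [h v hv]
  calc _ ≤ sliceNorm (pd j (Gamma a v)) T + ∑ m, sliceNorm (pd m v) T :=
        (sliceNorm_add_le (contDiff_pd (contDiff_Gamma hv a) j)
          (ContDiff.sum fun m _ => contDiff_const.mul (contDiff_pd hv m)) T).trans
          (add_le_add_right (sliceNorm_sum_le (fun m => contDiff_pd hv m) hc T) _)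
    _ ≤ A + ∑ _m : Fin 4, A := by gcongr with m; exacts [h1 j, h0 m]
    _ = 5 * A := by
        simp only [Finset.sum_const, Finset.card_univ, Fintype.card_fin, nsmul_eq_mul]
        push_cast
        ring

theorem sliceNorm_Gamma_Gamma_pd_le {v : SpaceTime → ℝ} (hv : ContDiff ℝ ∞ v) {T : ℝ} {A : ℝ≥0∞}
    (a b : GammaIndex) (h0 : ∀ m, sliceNorm (pd m v) T ≤ A)
    (h1 : ∀ a m, sliceNorm (pd m (Gamma a v)) T ≤ A)
    (h2 : ∀ m, sliceNorm (pd m (Gamma a (Gamma b v))) T ≤ A) (j : Fin 4) :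
    sliceNorm (Gamma a (Gamma b (pd j v))) T ≤ 25 * A := by
  obtain ⟨c, hc, h⟩ := exists_Gamma_pd b j
  have hG := contDiff_Gamma hv b
  have hm := fun m => contDiff_pd hv m
  rw [h v hv, Gamma_add (contDiff_pd hG j) (ContDiff.sum fun m _ => contDiff_const.mul (hm m)),
    Gamma_sum _ (fun m => contDiff_const.mul (hm m))]
  simp only [Gamma_const_mul (hm _)]
  calc _ ≤ sliceNorm (Gamma a (pd j (Gamma b v))) T + ∑ m, sliceNorm (Gamma a (pd m v)) T :=
        (sliceNorm_add_le (contDiff_Gamma (contDiff_pd hG j) a)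
          (ContDiff.sum fun m _ => contDiff_const.mul (contDiff_Gamma (hm m) a)) T).trans
          (add_le_add_right (sliceNorm_sum_le (fun m => contDiff_Gamma (hm m) a) hc T) _)
    _ ≤ 5 * A + ∑ _m : Fin 4, 5 * A := by
        gcongr with m
        · exact sliceNorm_Gamma_pd_le hG a (h1 b) h2 j
        · exact sliceNorm_Gamma_pd_le hv a h0 (h1 a) m
    _ = 25 * A := by
        simp only [Finset.sum_const, Finset.card_univ, Fintype.card_fin, nsmul_eq_mul]
        push_cast
        ring

/-- The sum of the squares of all `Γ^α f` with `|α| ≤ 2`. -/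
noncomputable def gammaDensity (f : SpaceTime → ℝ) (p : SpaceTime) : ℝ :=
  f p ^ 2 + ∑ a, Gamma a f p ^ 2 + ∑ a, ∑ b, Gamma a (Gamma b f) p ^ 2

theorem continuous_gammaDensity {f : SpaceTime → ℝ} (hf : ContDiff ℝ ∞ f) :
    Continuous (gammaDensity f) := by
  have h0 := hf.continuous
  have h1 := fun a => (contDiff_Gamma hf a).continuous
  have h2 := fun a b => (contDiff_Gamma (contDiff_Gamma hf b) a).continuous
  unfold gammaDensity
  fun_prop

theorem gammaDensity_nonneg (f : SpaceTime → ℝ) (p : SpaceTime) : 0 ≤ gammaDensity f p := by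
  unfold gammaDensity
  positivity

theorem sq_le_gammaDensity (f : SpaceTime → ℝ) (p : SpaceTime) : f p ^ 2 ≤ gammaDensity f p := by
  have h1 : 0 ≤ ∑ a, Gamma a f p ^ 2 := by positivity
  have h2 : 0 ≤ ∑ a, ∑ b, Gamma a (Gamma b f) p ^ 2 := by positivity
  unfold gammaDensity
  linarith

theorem sum_Gamma_sq_le_gammaDensity (f : SpaceTime → ℝ) (p : SpaceTime) :
    ∑ a, Gamma a f p ^ 2 ≤ gammaDensity f p := by
  have h1 : 0 ≤ f p ^ 2 := by positivity
  have h2 : 0 ≤ ∑ a, ∑ b, Gamma a (Gamma b f) p ^ 2 := by positivity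
  unfold gammaDensity
  linarith

theorem sum_Gamma_Gamma_sq_le_gammaDensity (f : SpaceTime → ℝ) (p : SpaceTime) :
    ∑ a, ∑ b, Gamma a (Gamma b f) p ^ 2 ≤ gammaDensity f p := by
  have h1 : 0 ≤ f p ^ 2 := by positivity
  have h2 : 0 ≤ ∑ a, Gamma a f p ^ 2 := by positivity
  unfold gammaDensity
  linarith

theorem measurable_ofReal_slice {f : SpaceTime → ℝ} (hf : Continuous f) (T : ℝ) :
    Measurable fun x : Space => ENNReal.ofReal (f (T, x)) := by
  have : Continuous fun x : Space => f (T, x) := by fun_prop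
  exact this.measurable.ennreal_ofReal

theorem measurable_ofReal_sq_slice {f : SpaceTime → ℝ} (hf : Continuous f) (T : ℝ) :
    Measurable fun x : Space => ENNReal.ofReal (f (T, x) ^ 2) :=
  measurable_ofReal_slice (f := fun p => f p ^ 2) (hf.pow 2) T

theorem lintegral_gammaDensity {f : SpaceTime → ℝ} (hf : ContDiff ℝ ∞ f) (T : ℝ) :
    ∫⁻ x : Space, ENNReal.ofReal (gammaDensity f (T, x)) = sliceNorm f T ^ 2 +
      ∑ a, sliceNorm (Gamma a f) T ^ 2 + ∑ a, ∑ b, sliceNorm (Gamma a (Gamma b f)) T ^ 2 := by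
  have m0 := measurable_ofReal_sq_slice hf.continuous T
  have m1 := fun a => measurable_ofReal_sq_slice (contDiff_Gamma hf a).continuous T
  have m2 := fun a b =>
    measurable_ofReal_sq_slice (contDiff_Gamma (contDiff_Gamma hf b) a).continuous T
  have e : ∀ x : Space, ENNReal.ofReal (gammaDensity f (T, x)) = ENNReal.ofReal (f (T, x) ^ 2) +
      ∑ a, ENNReal.ofReal (Gamma a f (T, x) ^ 2) +
      ∑ a, ∑ b, ENNReal.ofReal (Gamma a (Gamma b f) (T, x) ^ 2) := fun x => by
    rw [gammaDensity, ENNReal.ofReal_add (by positivity) (by positivity),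
      ENNReal.ofReal_add (by positivity) (by positivity),
      ENNReal.ofReal_sum_of_nonneg fun _ _ => by positivity,
      ENNReal.ofReal_sum_of_nonneg fun _ _ => by positivity]
    congr 1
    exact Finset.sum_congr rfl fun _ _ => ENNReal.ofReal_sum_of_nonneg fun _ _ => by positivity
  have m3 : Measurable fun x : Space => ENNReal.ofReal (f (T, x) ^ 2) +
      ∑ a, ENNReal.ofReal (Gamma a f (T, x) ^ 2) :=
    m0.add (Finset.measurable_fun_sum _ fun a _ => m1 a)
  simp only [e]
  rw [lintegral_add_left m3,
    lintegral_add_left m0, lintegral_finsetSum _ fun a _ => m1 a,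
    lintegral_finsetSum _ fun a _ => Finset.measurable_fun_sum _ fun b _ => m2 a b]
  simp only [sliceNorm_sq]
  congr 1
  exact Finset.sum_congr rfl fun a _ => lintegral_finsetSum _ fun b _ => m2 a b

theorem lintegral_gammaDensity_pd_le {v : SpaceTime → ℝ} (hv : ContDiff ℝ ∞ v) {T : ℝ} {A : ℝ≥0∞}
    (h0 : ∀ m, sliceNorm (pd m v) T ≤ A) (h1 : ∀ a m, sliceNorm (pd m (Gamma a v)) T ≤ A)
    (h2 : ∀ a b m, sliceNorm (pd m (Gamma a (Gamma b v))) T ≤ A) (j : Fin 4) :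
    ∫⁻ x : Space, ENNReal.ofReal (gammaDensity (pd j v) (T, x)) ≤
      (1 + Fintype.card GammaIndex + Fintype.card GammaIndex ^ 2) * (25 * A) ^ 2 := by
  rw [lintegral_gammaDensity (contDiff_pd hv j)]
  have hle : ∀ {n : ℝ≥0∞}, n ≤ 25 → n * A ≤ 25 * A := fun h => by gcongr
  calc _ ≤ (25 * A) ^ 2 + ∑ _a : GammaIndex, (25 * A) ^ 2
        + ∑ _a : GammaIndex, ∑ _b : GammaIndex, (25 * A) ^ 2 := by
        gcongr with a _ a _ b
        · exact (h0 j).trans (by simpa using hle (n := 1) (by norm_num))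
        · exact (sliceNorm_Gamma_pd_le hv a h0 (h1 a) j).trans (hle (by norm_num))
        · exact sliceNorm_Gamma_Gamma_pd_le hv a b h0 h1 (h2 a b) j
    _ = _ := by
        simp only [Finset.sum_const, Finset.card_univ, nsmul_eq_mul]
        ring

/-! ### The interior of the light cone -/

/-- The sum of all `|Γ ∂_m v|`. -/
noncomputable def gammaGradSum (v : SpaceTime → ℝ) (p : SpaceTime) : ℝ :=
  ∑ q : GammaIndex × Fin 4, |Gamma q.1 (pd q.2 v) p|

theorem abs_boost_le_gammaGradSum (v : SpaceTime → ℝ) (T : ℝ) (x : Space) (k : Fin 3) (m : Fin 4) :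
    |x k * pd 0 (pd m v) (T, x) + T * pd k.succ (pd m v) (T, x)| ≤ gammaGradSum v (T, x) :=
  Finset.single_le_sum (f := fun q : GammaIndex × Fin 4 => |Gamma q.1 (pd q.2 v) (T, x)|)
    (fun _ _ => abs_nonneg _)
    (Finset.mem_univ ((Sum.inr ⟨(0, k.succ), Fin.succ_pos k⟩ : GammaIndex), m))

/-- Away from the light cone the wave equation and the Lorentz boosts control all second derivatives
with a gain of `T⁻¹`: solving for `∂_t²` uses the identity
`(T² - |x|²) ∂_t² = T² □ + T ∑ Ω_{0k} ∂_k - ∑ x_k Ω_{0k} ∂_t`. -/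
theorem abs_mul_pd_pd_le {v : SpaceTime → ℝ} (hv : ContDiff ℝ ∞ v) {T : ℝ} (hT : 0 < T) {x : Space}
    (hx : ‖x‖ ≤ 3 / 4 * T) (i j : Fin 4) :
    T * |pd i (pd j v) (T, x)| ≤ 16 * (T * |box v (T, x)| + gammaGradSum v (T, x)) := by
  set p : SpaceTime := (T, x) with hp
  set S := gammaGradSum v p with hS
  set b := box v p with hb
  set w := pd 0 (pd 0 v) p with hw
  have hG := abs_boost_le_gammaGradSum v T x
  simp only [← hp, ← hS] at hG
  have hS0 : 0 ≤ S := Finset.sum_nonneg fun _ _ => abs_nonneg _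
  have hxk : ∀ k, |x k| ≤ 3 / 4 * T := fun k => (PiLp.norm_apply_le x k).trans hx
  have hxT : ∀ k, |x k| ≤ T := fun k => (hxk k).trans (by linarith)
  have hcomm : ∀ k : Fin 3, pd 0 (pd k.succ v) p = pd k.succ (pd 0 v) p := fun k => by
    rw [pd_comm hv]
  have hnorm : x 0 ^ 2 + x 1 ^ 2 + x 2 ^ 2 = ‖x‖ ^ 2 := by
    rw [EuclideanSpace.norm_sq_eq, Fin.sum_univ_three]
    simp
  have hbox : b = w - ∑ k : Fin 3, pd k.succ (pd k.succ v) p := rfl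
  have h00 : T * |w| ≤ 3 * (T * |b|) + 14 * S := by
    have e : (T ^ 2 - ‖x‖ ^ 2) * w = T ^ 2 * b + ∑ k : Fin 3,
        (T * (x k * pd 0 (pd k.succ v) p + T * pd k.succ (pd k.succ v) p)
          - x k * (x k * pd 0 (pd 0 v) p + T * pd k.succ (pd 0 v) p)) := by
      rw [hbox, ← hnorm]
      simp only [hcomm, ← hw, Fin.sum_univ_three]
      ring
    have e2 : (T ^ 2 - ‖x‖ ^ 2) * |w| ≤ T ^ 2 * |b| + 6 * (T * S) := by
      have hpos : 0 ≤ T ^ 2 - ‖x‖ ^ 2 := by nlinarith [norm_nonneg x]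
      rw [← abs_of_nonneg hpos, ← abs_mul, e]
      refine (abs_add_le _ _).trans (add_le_add ?_ ?_)
      · rw [abs_mul, abs_of_nonneg (sq_nonneg T)]
      · refine (Finset.abs_sum_le_sum_abs _ _).trans ?_
        refine (Finset.sum_le_card_nsmul _ _ (2 * (T * S)) fun k _ => ?_).trans (le_of_eq ?_)
        · refine (abs_sub _ _).trans ?_
          rw [abs_mul, abs_mul, abs_of_pos hT]
          have a1 := mul_le_mul_of_nonneg_left (hG k k.succ) hT.le
          have a2 := mul_le_mul (hxT k) (hG k 0) (abs_nonneg _) hT.le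
          linarith
        · simp
          ring
    have e3 : 7 / 16 * T ^ 2 ≤ T ^ 2 - ‖x‖ ^ 2 := by
      have : ‖x‖ ^ 2 ≤ (3 / 4 * T) ^ 2 := by gcongr
      linarith
    have e4 : T * (7 / 16 * (T * |w|)) ≤ T * (T * |b| + 6 * S) := by
      nlinarith [mul_le_mul_of_nonneg_right e3 (abs_nonneg w)]
    have e5 := le_of_mul_le_mul_left e4 hT
    have : 0 ≤ T * |b| := by positivity
    linarith
  have step : ∀ (k : Fin 3) (m : Fin 4), T * |pd k.succ (pd m v) p| ≤
      S + 3 / 4 * (T * |pd 0 (pd m v) p|) := fun k m => by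
    have h1 : T * pd k.succ (pd m v) p = (x k * pd 0 (pd m v) p + T * pd k.succ (pd m v) p)
        - x k * pd 0 (pd m v) p := by ring
    rw [← abs_of_pos hT, ← abs_mul, h1, abs_of_pos hT]
    refine (abs_sub _ _).trans (add_le_add (hG k m) ?_)
    rw [abs_mul]
    nlinarith [mul_le_mul_of_nonneg_right (hxk k) (abs_nonneg (pd 0 (pd m v) p))]
  have hTb : 0 ≤ T * |b| := by positivity
  have hk0 : ∀ k : Fin 3, T * |pd k.succ (pd 0 v) p| ≤ 3 * (T * |b|) + 15 * S := fun k => by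
    have := step k 0
    rw [← hw] at this
    linarith
  refine Fin.cases ?_ (fun k => ?_) i
  · refine Fin.cases ?_ (fun l => ?_) j
    · rw [← hw]
      linarith
    · rw [hcomm]
      have := hk0 l
      linarith
  · refine Fin.cases ?_ (fun l => ?_) j
    · have := hk0 k
      linarith
    · have := step k l.succ
      rw [hcomm] at this
      have := hk0 l
      linarith

theorem spd_slice {f : SpaceTime → ℝ} (hf : ContDiff ℝ ∞ f) (T : ℝ) (k : Fin 3) :
    spd k (fun x : Space => f (T, x)) = fun x => pd k.succ f (T, x) := by
  ext x
  rw [spd, (hasFDerivAt_slice hf T x).fderiv]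
  rfl

theorem mul_pd_pd_sq_le {v : SpaceTime → ℝ} (hv : ContDiff ℝ ∞ v) {T : ℝ} (hT : 0 < T) {x : Space}
    (hx : ‖x‖ ≤ 3 / 4 * T) (i j : Fin 4) :
    T ^ 2 * pd i (pd j v) (T, x) ^ 2 ≤ 512 * (T ^ 2 * box v (T, x) ^ 2 +
      (Fintype.card (GammaIndex × Fin 4) : ℝ) * ∑ m, ∑ a, Gamma a (pd m v) (T, x) ^ 2) := by
  have h1 := abs_mul_pd_pd_le hv hT hx i j
  have h2 : gammaGradSum v (T, x) ^ 2 ≤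
      (Fintype.card (GammaIndex × Fin 4) : ℝ) * ∑ m, ∑ a, Gamma a (pd m v) (T, x) ^ 2 := by
    refine sq_sum_le_card_mul_sum_sq.trans (le_of_eq ?_)
    rw [Fintype.sum_prod_type_right]
    simp [sq_abs]
  have h3 : (T * |pd i (pd j v) (T, x)|) ^ 2 ≤
      (16 * (T * |box v (T, x)| + gammaGradSum v (T, x))) ^ 2 := by gcongr
  rw [mul_pow, sq_abs] at h3
  have h4 : (T * |box v (T, x)|) ^ 2 = T ^ 2 * box v (T, x) ^ 2 := by rw [mul_pow, sq_abs]
  nlinarith [sq_nonneg (T * |box v (T, x)| - gammaGradSum v (T, x))]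

/-- The second derivative estimate in the interior, applied to `w` and to `∂_j w`. -/
theorem sobolevDensity_interior_le {w : SpaceTime → ℝ} (hw : ContDiff ℝ ∞ w) {T : ℝ} (hT : 0 < T)
    {x : Space} (hx : ‖x‖ ≤ 3 / 4 * T) (j : Fin 4) :
    T ^ 2 * sobolevDensity (T / 4) (fun y : Space => pd j w (T, y)) x ≤
      16384 * (Fintype.card (GammaIndex × Fin 4) : ℝ) * (∑ m, gammaDensity (pd m w) (T, x) +
        T ^ 2 * box w (T, x) ^ 2 + T ^ 2 * pd j (box w) (T, x) ^ 2) := by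
  have hj := contDiff_pd hw j
  set N : ℝ := (Fintype.card (GammaIndex × Fin 4) : ℝ) with hN
  have hN1 : 1 ≤ N := by
    rw [hN]
    exact_mod_cast Fintype.card_pos
  set D := ∑ m, gammaDensity (pd m w) (T, x) with hD
  have hDnn : 0 ≤ D := Finset.sum_nonneg fun _ _ => gammaDensity_nonneg _ _
  have hDj : gammaDensity (pd j w) (T, x) ≤ D :=
    Finset.single_le_sum (f := fun m => gammaDensity (pd m w) (T, x))
      (fun _ _ => gammaDensity_nonneg _ _) (Finset.mem_univ j)
  have s1 : ∑ m, ∑ a, Gamma a (pd m w) (T, x) ^ 2 ≤ D :=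
    Finset.sum_le_sum fun m _ => sum_Gamma_sq_le_gammaDensity _ _
  have s2 : ∑ m, ∑ a, Gamma a (pd m (pd j w)) (T, x) ^ 2 ≤ D := by
    refine le_trans ?_ ((sum_Gamma_Gamma_sq_le_gammaDensity (pd j w) (T, x)).trans hDj)
    rw [Finset.sum_comm]
    refine Finset.sum_le_sum fun a _ => ?_
    rw [Fintype.sum_sum_type]
    exact le_add_of_nonneg_right (by positivity)
  have hspd : ∀ k, spd k (fun y : Space => pd j w (T, y)) x = pd k.succ (pd j w) (T, x) :=
    fun k => by rw [spd_slice hj]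
  have hspd2 : ∀ k l, spd l (spd k (fun y : Space => pd j w (T, y))) x =
      pd l.succ (pd k.succ (pd j w)) (T, x) := fun k l => by
    rw [spd_slice hj, spd_slice (contDiff_pd hj _)]
  set b2 := T ^ 2 * box w (T, x) ^ 2 with hb2
  set c2 := T ^ 2 * pd j (box w) (T, x) ^ 2 with hc2
  have hb0 : 0 ≤ b2 := by positivity
  have hc0 : 0 ≤ c2 := by positivity
  have d1 : ∀ k : Fin 3, T ^ 2 * pd k.succ (pd j w) (T, x) ^ 2 ≤ 512 * (b2 + N * D) := fun k =>
    (mul_pd_pd_sq_le hw hT hx _ _).trans (by gcongr)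
  have d2 : ∀ k l : Fin 3, T ^ 2 * pd l.succ (pd k.succ (pd j w)) (T, x) ^ 2 ≤
      512 * (c2 + N * D) := fun k l => by
    refine (mul_pd_pd_sq_le hj hT hx _ _).trans ?_
    rw [box_pd hw]
    gcongr
  have d0 : pd j w (T, x) ^ 2 ≤ D := (sq_le_gammaDensity _ _).trans hDj
  have e : T ^ 2 * sobolevDensity (T / 4) (fun y : Space => pd j w (T, y)) x =
      16 * pd j w (T, x) ^ 2 + ∑ k : Fin 3, T ^ 2 * pd k.succ (pd j w) (T, x) ^ 2 +
        ∑ k : Fin 3, ∑ l : Fin 3, T ^ 2 * pd l.succ (pd k.succ (pd j w)) (T, x) ^ 2 := by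
    simp only [sobolevDensity, hspd, hspd2, ← Finset.mul_sum]
    field_simp
    ring
  have f1 : ∑ k : Fin 3, T ^ 2 * pd k.succ (pd j w) (T, x) ^ 2 ≤ 3 * (512 * (b2 + N * D)) := by
    refine (Finset.sum_le_sum fun k _ => d1 k).trans (le_of_eq ?_)
    simp
  have f2 : ∑ k : Fin 3, ∑ l : Fin 3, T ^ 2 * pd l.succ (pd k.succ (pd j w)) (T, x) ^ 2 ≤
      9 * (512 * (c2 + N * D)) := by
    refine (Finset.sum_le_sum fun k _ => Finset.sum_le_sum fun l _ => d2 k l).trans (le_of_eq ?_)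
    simp
    ring
  rw [e]
  nlinarith [mul_le_mul_of_nonneg_right hN1 hDnn, mul_le_mul_of_nonneg_right hN1 hb0,
    mul_le_mul_of_nonneg_right hN1 hc0]

/-- The decay estimate in `|X| ≤ T / 2`. -/
theorem exists_interior_bound {a : ℝ} (ha : 0 < a) : ∃ C : ℝ≥0, ∀ w : SpaceTime → ℝ,
    ContDiff ℝ ∞ w → ∀ (T : ℝ) (X : Space) (j : Fin 4), a ≤ T → ‖X‖ ≤ T / 2 →
      ENNReal.ofReal (T ^ 2 * pd j w (T, X) ^ 2) ≤
        C * ((∑ m, ∫⁻ x : Space, ENNReal.ofReal (gammaDensity (pd m w) (T, x))) +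
          (ENNReal.ofReal T * sliceNorm (box w) T) ^ 2 +
          (ENNReal.ofReal T * sliceNorm (pd j (box w)) T) ^ 2) := by
  obtain ⟨K, hK⟩ := exists_local_sobolev (R₀ := a / 4) (by positivity)
  set c : ℝ := 16384 * (Fintype.card (GammaIndex × Fin 4) : ℝ) with hc
  have hc0 : 0 ≤ c := by positivity
  refine ⟨K * c.toNNReal, fun w hw T X j haT hX => ?_⟩
  have hT : 0 < T := ha.trans_le haT
  have hj := contDiff_pd hw j
  have hg : ContDiff ℝ ∞ fun y : Space => pd j w (T, y) := hj.comp (contDiff_prodMk_right T)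
  have hsob := hK univ (fun y : Space => pd j w (T, y)) X (T / 4) isOpen_univ hg.contDiffOn
    hg.continuous.measurable (by linarith) (subset_univ _)
  have m1 := fun m => measurable_ofReal_slice (continuous_gammaDensity (contDiff_pd hw m)) T
  have m2 := measurable_ofReal_sq_slice (contDiff_box hw).continuous T
  have m3 := measurable_ofReal_sq_slice (contDiff_pd (contDiff_box hw) j).continuous T
  have hpt : ∀ x ∈ Metric.closedBall X (T / 4), ENNReal.ofReal (T ^ 2) *
      ENNReal.ofReal (sobolevDensity (T / 4) (fun y : Space => pd j w (T, y)) x) ≤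
      ENNReal.ofReal c * (∑ m, ENNReal.ofReal (gammaDensity (pd m w) (T, x)) +
        ENNReal.ofReal (T ^ 2) * ENNReal.ofReal (box w (T, x) ^ 2) +
        ENNReal.ofReal (T ^ 2) * ENNReal.ofReal (pd j (box w) (T, x) ^ 2)) := by
    intro x hx
    have hx' : ‖x‖ ≤ 3 / 4 * T := by
      have h1 : ‖x - X‖ ≤ T / 4 := by rwa [← dist_eq_norm]
      have h2 : ‖x‖ ≤ ‖x - X‖ + ‖X‖ := by simpa using norm_add_le (x - X) X
      linarith
    have hD : 0 ≤ ∑ m, gammaDensity (pd m w) (T, x) :=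
      Finset.sum_nonneg fun _ _ => gammaDensity_nonneg _ _
    rw [← ENNReal.ofReal_sum_of_nonneg fun _ _ => gammaDensity_nonneg _ _,
      ← ENNReal.ofReal_mul (by positivity), ← ENNReal.ofReal_mul (by positivity),
      ← ENNReal.ofReal_mul (by positivity), ← ENNReal.ofReal_add hD (by positivity),
      ← ENNReal.ofReal_add (by positivity) (by positivity), ← ENNReal.ofReal_mul hc0]
    exact ENNReal.ofReal_le_ofReal (sobolevDensity_interior_le hw hT hx' j)
  have hT2 : ENNReal.ofReal (T ^ 2) = ENNReal.ofReal T ^ 2 := ENNReal.ofReal_pow hT.le 2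
  rw [ENNReal.ofReal_mul (by positivity)]
  calc ENNReal.ofReal (T ^ 2) * ENNReal.ofReal (pd j w (T, X) ^ 2)
      ≤ ENNReal.ofReal (T ^ 2) * (K * ∫⁻ x in Metric.closedBall X (T / 4),
          ENNReal.ofReal (sobolevDensity (T / 4) (fun y : Space => pd j w (T, y)) x)) := by
        gcongr
    _ = K * ∫⁻ x in Metric.closedBall X (T / 4), ENNReal.ofReal (T ^ 2) *
          ENNReal.ofReal (sobolevDensity (T / 4) (fun y : Space => pd j w (T, y)) x) := by
        rw [lintegral_const_mul' _ _ ENNReal.ofReal_ne_top, mul_left_comm]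
    _ ≤ K * ∫⁻ x in Metric.closedBall X (T / 4), ENNReal.ofReal c *
          (∑ m, ENNReal.ofReal (gammaDensity (pd m w) (T, x)) +
          ENNReal.ofReal (T ^ 2) * ENNReal.ofReal (box w (T, x) ^ 2) +
          ENNReal.ofReal (T ^ 2) * ENNReal.ofReal (pd j (box w) (T, x) ^ 2)) := by
        gcongr K * ?_
        exact setLIntegral_mono' measurableSet_closedBall hpt
    _ ≤ K * ∫⁻ x : Space, ENNReal.ofReal c *
          (∑ m, ENNReal.ofReal (gammaDensity (pd m w) (T, x)) +
          ENNReal.ofReal (T ^ 2) * ENNReal.ofReal (box w (T, x) ^ 2) +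
          ENNReal.ofReal (T ^ 2) * ENNReal.ofReal (pd j (box w) (T, x) ^ 2)) := by
        gcongr K * ?_
        exact setLIntegral_le_lintegral _ _
    _ = _ := by
        have m4 : Measurable fun x : Space => ∑ m, ENNReal.ofReal (gammaDensity (pd m w) (T, x)) +
            ENNReal.ofReal (T ^ 2) * ENNReal.ofReal (box w (T, x) ^ 2) :=
          (Finset.measurable_fun_sum _ fun m _ => m1 m).add (m2.const_mul _)
        rw [lintegral_const_mul' _ _ ENNReal.ofReal_ne_top, lintegral_add_left m4,
          lintegral_add_left (Finset.measurable_fun_sum _ fun m _ => m1 m),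
          lintegral_finsetSum _ fun m _ => m1 m, lintegral_const_mul _ m2,
          lintegral_const_mul _ m3, mul_pow, mul_pow, sliceNorm_sq, sliceNorm_sq, hT2,
          ENNReal.coe_mul, mul_assoc]
        rfl

/-! ### The exterior region -/

/-- The radial map that sends the sphere of radius `ρ` to the sphere of radius `r + c (ρ - 1)`. -/
noncomputable def radialShift (r c : ℝ) (y : Space) : Space := ((r - c) * ‖y‖⁻¹ + c) • y

theorem radialShift_smul {r c s : ℝ} (hs : 0 < s) {ξ : Space} (hξ : ‖ξ‖ = 1) :
    radialShift r c (s • ξ) = (r + c * (s - 1)) • ξ := by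
  rw [radialShift, norm_smul, hξ, Real.norm_of_nonneg hs.le, mul_one, smul_smul]
  congr 1
  field_simp
  ring

theorem measurable_radialShift (r c : ℝ) : Measurable (radialShift r c) := by
  unfold radialShift
  fun_prop

theorem contDiffOn_radialShift (r c : ℝ) : ContDiffOn ℝ ∞ (radialShift r c) {0}ᶜ := by
  intro y hy
  have h1 : ContDiffAt ℝ ∞ (fun y : Space => ‖y‖) y := contDiffAt_norm ℝ hy
  have h2 := h1.inv (norm_ne_zero_iff.2 hy)
  exact (((contDiffAt_const.mul h2).add contDiffAt_const).smul contDiffAt_id).contDiffWithinAt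

/-- The coefficient of the field `Γ_a` in the pull-back of `∂_k` by `radialShift`. It vanishes when
`Γ_a` involves `∂_t`, since `coord 0 (0, y) = 0`. -/
noncomputable def shiftCoeff (c : ℝ) (k : Fin 3) (a : GammaIndex) (y : Space) : ℝ :=
  (match a with
    | Sum.inl i => c * y k * coord i ((0, y) : SpaceTime)
    | Sum.inr q => (if q.1.2 = k.succ then coord q.1.1 ((0, y) : SpaceTime) else 0)
        - (if q.1.1 = k.succ then coord q.1.2 ((0, y) : SpaceTime) else 0)) * (‖y‖ ^ 2)⁻¹

theorem contDiffOn_shiftCoeff (c : ℝ) (k : Fin 3) (a : GammaIndex) :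
    ContDiffOn ℝ ∞ (shiftCoeff c k a) {0}ᶜ := by
  have h0 : ∀ i, ContDiff ℝ ∞ fun y : Space => coord i ((0, y) : SpaceTime) := fun i =>
    (contDiff_coord i).comp (contDiff_prodMk_right 0)
  have h1 : ContDiffOn ℝ ∞ (fun y : Space => (‖y‖ ^ 2)⁻¹) {0}ᶜ :=
    (contDiff_id.norm_sq ℝ).contDiffOn.inv fun y hy => pow_ne_zero 2 (norm_ne_zero_iff.2 hy)
  refine ContDiffOn.mul ?_ h1
  rcases a with i | q
  · exact ((contDiff_const.mul (by fun_prop)).mul (h0 i)).contDiffOn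
  · refine ContDiff.contDiffOn (ContDiff.sub ?_ ?_)
    · split_ifs
      exacts [h0 _, contDiff_const]
    · split_ifs
      exacts [h0 _, contDiff_const]

theorem sum_shiftCoeff_mul (c : ℝ) (k : Fin 3) (f : SpaceTime → ℝ) (T : ℝ) (x y : Space) :
    ∑ a, shiftCoeff c k a y * Gamma a f (T, x) =
      (c * y k * ∑ i : Fin 3, y i * pd i.succ f (T, x) +
        ∑ i : Fin 3, y i * (x i * pd k.succ f (T, x) - x k * pd i.succ f (T, x))) *
        (‖y‖ ^ 2)⁻¹ := by
  have hsub : ∀ F : Fin 4 × Fin 4 → ℝ, ∑ q : {q : Fin 4 × Fin 4 // q.1 < q.2}, F q.1 =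
      ∑ q : Fin 4 × Fin 4, if q.1 < q.2 then F q else 0 := fun F => by
    rw [← Finset.sum_filter]
    exact (Finset.sum_subtype _ (by simp) F).symm
  rw [Fintype.sum_sum_type]
  simp only [shiftCoeff, Gamma]
  rw [hsub fun q => ((if q.2 = k.succ then coord q.1 ((0, y) : SpaceTime) else 0)
        - (if q.1 = k.succ then coord q.2 ((0, y) : SpaceTime) else 0)) * (‖y‖ ^ 2)⁻¹ *
        Omega q.1 q.2 f (T, x)]
  have c0 : ∀ p : SpaceTime, coord 0 p = p.1 := fun _ => rfl
  have c1 : ∀ p : SpaceTime, coord 1 p = p.2 0 := fun _ => rfl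
  have c2 : ∀ p : SpaceTime, coord 2 p = p.2 1 := fun _ => rfl
  have c3 : ∀ p : SpaceTime, coord 3 p = p.2 2 := fun _ => rfl
  have s0 : (0 : Fin 3).succ = (1 : Fin 4) := rfl
  have s1 : (1 : Fin 3).succ = (2 : Fin 4) := rfl
  have s2 : (2 : Fin 3).succ = (3 : Fin 4) := rfl
  rw [Fintype.sum_prod_type]
  simp only [Fin.sum_univ_four, Fin.sum_univ_three, Omega, c0, c1, c2, c3, s0, s1, s2]
  fin_cases k <;> simp [s0, s1, s2] <;> ring

/-- The chain rule for `radialShift`: the pull-back of `∂_k` is a combination of the fields `Γ` with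
coefficients that are smooth and bounded away from the origin. -/
theorem spd_comp_radialShift {f : SpaceTime → ℝ} (hf : ContDiff ℝ ∞ f) (T r c : ℝ) (k : Fin 3)
    {y : Space} (hy : y ≠ 0) :
    spd k (fun y => f (T, radialShift r c y)) y =
      ∑ a, shiftCoeff c k a y * Gamma a f (T, radialShift r c y) := by
  set n := ‖y‖ with hn
  have hn0 : n ≠ 0 := norm_ne_zero_iff.2 hy
  set m := (r - c) * n⁻¹ + c with hm
  have hnsq : ∑ i : Fin 3, y i * y i = n ^ 2 := by
    rw [hn, EuclideanSpace.norm_sq_eq]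
    simp [sq]
  have hnorm : HasDerivAt (fun s : ℝ => ‖y + s • EuclideanSpace.single k (1 : ℝ)‖) (y k / n) 0 := by
    have h1 : HasDerivAt (fun s : ℝ => y + s • EuclideanSpace.single k (1 : ℝ))
        (EuclideanSpace.single k (1 : ℝ)) 0 := by
      simpa using ((hasDerivAt_id (0 : ℝ)).smul_const (EuclideanSpace.single k (1 : ℝ))).const_add y
    have h2 := h1.norm_sq.sqrt (by simpa using hy)
    simp only [Real.sqrt_sq (norm_nonneg _), zero_smul, add_zero] at h2
    refine h2.congr_deriv ?_
    rw [EuclideanSpace.inner_single_right]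
    simp [← hn]
    field_simp
  have hline : HasDerivAt (fun s : ℝ => y + s • EuclideanSpace.single k (1 : ℝ))
      (EuclideanSpace.single k (1 : ℝ)) 0 := by
    simpa using ((hasDerivAt_id (0 : ℝ)).smul_const (EuclideanSpace.single k (1 : ℝ))).const_add y
  have hΦ : HasDerivAt (fun s : ℝ => radialShift r c (y + s • EuclideanSpace.single k (1 : ℝ)))
      (m • EuclideanSpace.single k (1 : ℝ) + (-((r - c) * y k / n ^ 3)) • y) 0 := by
    have h3 := (((hnorm.fun_inv (by simpa using hy)).const_mul (r - c)).add_const c).smul hline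
    refine h3.congr_deriv ?_
    simp only [zero_smul, add_zero, ← hn, ← hm]
    congr 2
    field_simp
  let G : Space → ℝ := fun x => f (T, x)
  have hfd : HasFDerivAt G _ (radialShift r c y) :=
    hasFDerivAt_slice hf T (radialShift r c y)
  have hcomp := hfd.comp_hasDerivAt_of_eq 0 hΦ (by simp)
  have hdiff : DifferentiableAt ℝ (fun y => f (T, radialShift r c y)) y := by
    have h4 : DifferentiableAt ℝ (radialShift r c) y :=
      ((contDiffOn_radialShift r c).differentiableOn (by simp)).differentiableAt
        (isOpen_compl_singleton.mem_nhds hy)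
    exact hfd.differentiableAt.comp y h4
  have hspd : HasDerivAt
      (G ∘ fun s : ℝ => radialShift r c (y + s • EuclideanSpace.single k (1 : ℝ)))
      (spd k (fun y => f (T, radialShift r c y)) y) 0 :=
    hdiff.hasFDerivAt.comp_hasDerivAt_of_eq 0 hline (by simp)
  rw [hspd.unique hcomp, sum_shiftCoeff_mul]
  have hlin : ∀ v : Space, ((fderiv ℝ f (T, radialShift r c y)).comp
      (ContinuousLinearMap.inr ℝ ℝ Space)) v =
        ∑ i : Fin 3, v i * pd i.succ f (T, radialShift r c y) := fun v => by
    have hv : v = ∑ i, v i • EuclideanSpace.single i (1 : ℝ) := by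
      ext l
      simp [Pi.single_apply]
    conv_lhs => rw [hv]
    rw [map_sum]
    refine Finset.sum_congr rfl fun i _ => ?_
    rw [map_smul]
    rfl
  have hx : ∀ i, (radialShift r c y) i = m * y i := fun i => rfl
  rw [map_add, map_smul, map_smul, hlin, hlin]
  simp only [hx]
  set d : Fin 3 → ℝ := fun i => pd i.succ f (T, radialShift r c y) with hd
  have e1 : ∑ i : Fin 3, (EuclideanSpace.single k (1 : ℝ) : Space) i *
      pd i.succ f (T, radialShift r c y) = d k := by
    simp [hd]
  have e2 : ∑ i : Fin 3, y i * (m * y i * pd k.succ f (T, radialShift r c y)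
      - m * y k * pd i.succ f (T, radialShift r c y)) =
        m * n ^ 2 * d k - m * y k * ∑ i, y i * d i := by
    rw [← hnsq]
    simp only [hd, Fin.sum_univ_three]
    ring
  rw [e1, e2, hm]
  simp only [smul_eq_mul]
  change _ = (c * y k * ∑ i, y i * d i + _) * _
  change _ * d k + _ * ∑ i, y i * d i = _
  field_simp
  ring

theorem contDiffOn_comp_radialShift {f : SpaceTime → ℝ} (hf : ContDiff ℝ ∞ f) (T r c : ℝ) :
    ContDiffOn ℝ ∞ (fun y => f (T, radialShift r c y)) {0}ᶜ :=
  (hf.comp (contDiff_prodMk_right T)).comp_contDiffOn (contDiffOn_radialShift r c)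

theorem spd_spd_comp_radialShift {f : SpaceTime → ℝ} (hf : ContDiff ℝ ∞ f) (T r c : ℝ)
    (k l : Fin 3) {y : Space} (hy : y ≠ 0) :
    spd l (spd k fun y => f (T, radialShift r c y)) y =
      ∑ a, (spd l (shiftCoeff c k a) y * Gamma a f (T, radialShift r c y) +
        shiftCoeff c k a y *
          ∑ b, shiftCoeff c l b y * Gamma b (Gamma a f) (T, radialShift r c y)) := by
  have hev : spd k (fun y => f (T, radialShift r c y)) =ᶠ[𝓝 y]
      fun y => ∑ a, shiftCoeff c k a y * Gamma a f (T, radialShift r c y) := by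
    filter_upwards [isOpen_compl_singleton.mem_nhds hy] with z hz
      using spd_comp_radialShift hf T r c k hz
  have hnhds := isOpen_compl_singleton.mem_nhds (show y ∈ ({0}ᶜ : Set Space) from hy)
  have h1 : ∀ a, DifferentiableAt ℝ (shiftCoeff c k a) y := fun a =>
    ((contDiffOn_shiftCoeff c k a).differentiableOn (by simp)).differentiableAt hnhds
  have h2 : ∀ a, DifferentiableAt ℝ (fun y => Gamma a f (T, radialShift r c y)) y := fun a =>
    ((contDiffOn_comp_radialShift (contDiff_Gamma hf a) T r c).differentiableOn
      (by simp)).differentiableAt hnhds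
  rw [spd, hev.fderiv_eq, fderiv_fun_sum fun a _ => (h1 a).fun_mul (h2 a),
    sum_apply]
  refine Finset.sum_congr rfl fun a _ => ?_
  rw [fderiv_fun_mul (h1 a) (h2 a), ← spd_comp_radialShift (contDiff_Gamma hf a) T r c l hy]
  simp only [add_apply, smul_apply, smul_eq_mul, spd]
  ring

/-- The spherical shell in which `radialShift` is used. -/
def shell : Set Space := Metric.closedBall 0 (3 / 2) \ Metric.ball 0 (1 / 2)

theorem isCompact_shell : IsCompact shell := (isCompact_closedBall _ _).diff Metric.isOpen_ball

theorem mem_shell {y : Space} : y ∈ shell ↔ ‖y‖ ≤ 3 / 2 ∧ 1 / 2 ≤ ‖y‖ := by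
  simp [shell]

theorem ne_zero_of_mem_shell {y : Space} (hy : y ∈ shell) : y ≠ 0 := by
  rintro rfl
  have := (mem_shell.1 hy).2
  norm_num at this

theorem exists_shiftCoeff_bound (c : ℝ) : ∃ M : ℝ, ∀ y ∈ shell,
    (∀ k a, |shiftCoeff c k a y| ≤ M) ∧ ∀ k l a, |spd l (shiftCoeff c k a) y| ≤ M := by
  have hsub : shell ⊆ ({0}ᶜ : Set Space) := fun y hy => ne_zero_of_mem_shell hy
  have h1 : ∀ k a, ∃ M : ℝ, ∀ y ∈ shell, ‖shiftCoeff c k a y‖ ≤ M := fun k a =>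
    isCompact_shell.exists_bound_of_continuousOn ((contDiffOn_shiftCoeff c k a).continuousOn.mono
      hsub)
  have h2 : ∀ k l a, ∃ M : ℝ, ∀ y ∈ shell, ‖spd l (shiftCoeff c k a) y‖ ≤ M := fun k l a =>
    isCompact_shell.exists_bound_of_continuousOn ((contDiffOn_spd isOpen_compl_singleton
      (contDiffOn_shiftCoeff c k a) l).continuousOn.mono hsub)
  choose M1 hM1 using h1
  choose M2 hM2 using h2
  refine ⟨∑ k, ∑ a, |M1 k a| + ∑ k, ∑ l, ∑ a, |M2 k l a|, fun y hy => ⟨fun k a => ?_,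
    fun k l a => ?_⟩⟩
  · have e1 : |M1 k a| ≤ ∑ a, |M1 k a| :=
      Finset.single_le_sum (f := fun a => |M1 k a|) (fun _ _ => abs_nonneg _) (Finset.mem_univ a)
    have e2 : ∑ a, |M1 k a| ≤ ∑ k, ∑ a, |M1 k a| :=
      Finset.single_le_sum (f := fun k => ∑ a, |M1 k a|) (fun _ _ => by positivity)
        (Finset.mem_univ k)
    have e3 : 0 ≤ ∑ k, ∑ l, ∑ a, |M2 k l a| := by positivity
    have e4 := (hM1 k a y hy).trans (le_abs_self _)
    rw [Real.norm_eq_abs] at e4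
    linarith
  · have e1 : |M2 k l a| ≤ ∑ a, |M2 k l a| :=
      Finset.single_le_sum (f := fun a => |M2 k l a|) (fun _ _ => abs_nonneg _) (Finset.mem_univ a)
    have e2 : ∑ a, |M2 k l a| ≤ ∑ l, ∑ a, |M2 k l a| :=
      Finset.single_le_sum (f := fun l => ∑ a, |M2 k l a|) (fun _ _ => by positivity)
        (Finset.mem_univ l)
    have e5 : ∑ l, ∑ a, |M2 k l a| ≤ ∑ k, ∑ l, ∑ a, |M2 k l a| :=
      Finset.single_le_sum (f := fun k => ∑ l, ∑ a, |M2 k l a|) (fun _ _ => by positivity)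
        (Finset.mem_univ k)
    have e3 : 0 ≤ ∑ k, ∑ a, |M1 k a| := by positivity
    have e4 := (hM2 k l a y hy).trans (le_abs_self _)
    rw [Real.norm_eq_abs] at e4
    linarith

theorem sum_mul_sq_le {ι : Type*} [Fintype ι] {c g : ι → ℝ} {M : ℝ} (hc : ∀ i, |c i| ≤ M) :
    (∑ i, c i * g i) ^ 2 ≤ Fintype.card ι * M ^ 2 * ∑ i, g i ^ 2 := by
  refine (Finset.sum_mul_sq_le_sq_mul_sq _ _ _).trans ?_
  refine mul_le_mul_of_nonneg_right ?_ (by positivity)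
  refine (Finset.sum_le_card_nsmul _ _ (M ^ 2) fun i _ => ?_).trans (le_of_eq (by simp))
  rw [← sq_abs]
  exact pow_le_pow_left₀ (abs_nonneg _) (hc i) 2

theorem exists_sobolevDensity_shift_le (c : ℝ) : ∃ C : ℝ, 0 ≤ C ∧ ∀ f : SpaceTime → ℝ,
    ContDiff ℝ ∞ f → ∀ (T r : ℝ), ∀ y ∈ shell,
      sobolevDensity (1 / 2) (fun y => f (T, radialShift r c y)) y ≤
        C * gammaDensity f (T, radialShift r c y) := by
  obtain ⟨M, hM⟩ := exists_shiftCoeff_bound c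
  set N : ℝ := (Fintype.card GammaIndex : ℝ) with hN
  set P : ℝ := N * M ^ 2 with hP
  have hP0 : 0 ≤ P := by positivity
  refine ⟨4 + 3 * P + 9 * (2 * (P + P * P)), by positivity, fun f hf T r y hy => ?_⟩
  have hy0 := ne_zero_of_mem_shell hy
  obtain ⟨h1, h2⟩ := hM y hy
  set p : SpaceTime := (T, radialShift r c y) with hp
  set D := gammaDensity f p with hD
  have hD0 : f p ^ 2 ≤ D := sq_le_gammaDensity f p
  have hD1 : ∑ a, Gamma a f p ^ 2 ≤ D := sum_Gamma_sq_le_gammaDensity f p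
  have hD2 : ∑ a, ∑ b, Gamma b (Gamma a f) p ^ 2 ≤ D := by
    rw [Finset.sum_comm]
    exact sum_Gamma_Gamma_sq_le_gammaDensity f p
  have e1 : ∀ k, spd k (fun y => f (T, radialShift r c y)) y ^ 2 ≤ P * D := fun k => by
    rw [spd_comp_radialShift hf T r c k hy0]
    exact (sum_mul_sq_le (h1 k)).trans (by gcongr)
  have e2 : ∀ k l, spd l (spd k fun y => f (T, radialShift r c y)) y ^ 2 ≤
      2 * (P * D + P * P * D) := fun k l => by
    rw [spd_spd_comp_radialShift hf T r c k l hy0, Finset.sum_add_distrib]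
    refine (add_sq_le).trans ?_
    gcongr
    · exact (sum_mul_sq_le fun a => h2 k l a).trans (by gcongr)
    · refine (sum_mul_sq_le (h1 k)).trans ?_
      rw [mul_assoc P P D]
      refine mul_le_mul_of_nonneg_left ?_ hP0
      calc ∑ a, (∑ b, shiftCoeff c l b y * Gamma b (Gamma a f) p) ^ 2
          ≤ ∑ a, P * ∑ b, Gamma b (Gamma a f) p ^ 2 :=
            Finset.sum_le_sum fun a _ => sum_mul_sq_le (h1 l)
        _ = P * ∑ a, ∑ b, Gamma b (Gamma a f) p ^ 2 := by rw [Finset.mul_sum]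
        _ ≤ P * D := by gcongr
  have s1 : ∑ k, spd k (fun y => f (T, radialShift r c y)) y ^ 2 ≤ 3 * (P * D) :=
    (Finset.sum_le_sum fun k _ => e1 k).trans (le_of_eq (by simp))
  have s2 : ∑ k, ∑ l, spd l (spd k fun y => f (T, radialShift r c y)) y ^ 2 ≤
      9 * (2 * (P * D + P * P * D)) :=
    (Finset.sum_le_sum fun k _ => Finset.sum_le_sum fun l _ => e2 k l).trans
      (le_of_eq (by simp; ring))
  have s0 : f p ^ 2 / (1 / 2) ^ 2 ≤ 4 * D := by
    norm_num
    linarith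
  unfold sobolevDensity
  calc _ ≤ 4 * D + 3 * (P * D) + 9 * (2 * (P * D + P * P * D)) :=
        add_le_add (add_le_add s0 s1) s2
    _ = _ := by ring

/-- The change of variables `radialShift` gains a factor `r²`: it maps the unit shell to a shell
of radius comparable to `r`, without stretching the radial variable. -/
theorem lintegral_shell_radialShift_le {P : Space → ℝ≥0∞} (hP : Measurable P) {r c : ℝ} (hc : 0 < c)
    (hcr : c ≤ r) :
    ENNReal.ofReal (c * r ^ 2) * ∫⁻ y in shell, P (radialShift r c y) ≤ 9 * ∫⁻ x : Space, P x := by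
  have hr : 0 < r := hc.trans_le hcr
  have hms : MeasurableSet shell := isCompact_shell.measurableSet
  have hm : Measurable (shell.indicator fun y => P (radialShift r c y)) :=
    (hP.comp (measurable_radialShift r c)).indicator hms
  rw [← lintegral_indicator hms, lintegral_polar hm, lintegral_polar hP,
    ← lintegral_const_mul' _ _ ENNReal.ofReal_ne_top, ← lintegral_const_mul' _ _ (by norm_num)]
  refine lintegral_mono fun ξ => ?_
  have hξ : ‖(ξ : Space)‖ = 1 := by simp
  set H : ℝ → ℝ≥0∞ := fun s => ENNReal.ofReal (s ^ 2) * P (s • (ξ : Space)) with hH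
  set I : Set ℝ := Icc (1 / 2) (3 / 2) with hI
  have hpos : ∀ s ∈ I, r / 2 ≤ r + c * (s - 1) := fun s hs => by
    have h1 := hs.1
    nlinarith
  have hIoi : I ⊆ Ioi 0 := fun s hs => lt_of_lt_of_le (by norm_num : (0 : ℝ) < 1 / 2) hs.1
  calc ENNReal.ofReal (c * r ^ 2) * ∫⁻ s in Ioi (0 : ℝ), ENNReal.ofReal (s ^ 2) *
          shell.indicator (fun y => P (radialShift r c y)) (s • (ξ : Space))
      = ENNReal.ofReal (c * r ^ 2) * ∫⁻ s in I, ENNReal.ofReal (s ^ 2) *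
          P ((r + c * (s - 1)) • (ξ : Space)) := by
        congr 1
        rw [← lintegral_indicator measurableSet_Ioi, ← lintegral_indicator measurableSet_Icc]
        refine lintegral_congr fun s => ?_
        by_cases hs : 0 < s
        · have hmem : s • (ξ : Space) ∈ shell ↔ s ∈ I := by
            rw [mem_shell, norm_smul, hξ, Real.norm_of_nonneg hs.le, mul_one, and_comm]
            rfl
          rw [indicator_of_mem (mem_Ioi.2 hs)]
          by_cases hsI : s ∈ I
          · rw [indicator_of_mem hsI, indicator_of_mem (hmem.2 hsI), radialShift_smul hs hξ]
          · rw [indicator_of_notMem hsI, indicator_of_notMem fun h => hsI (hmem.1 h), mul_zero]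
        · rw [indicator_of_notMem (by simpa using hs), indicator_of_notMem fun h => hs (hIoi h)]
    _ = ∫⁻ s in I, ENNReal.ofReal (c * r ^ 2) * (ENNReal.ofReal (s ^ 2) *
          P ((r + c * (s - 1)) • (ξ : Space))) := by
        rw [lintegral_const_mul' _ _ ENNReal.ofReal_ne_top]
    _ ≤ ∫⁻ s in I, 9 * (ENNReal.ofReal |c| * H (r + c * (s - 1))) := by
        refine setLIntegral_mono' measurableSet_Icc fun s hs => ?_
        have h1 := hpos s hs
        have h2 : c * r ^ 2 * s ^ 2 ≤ 9 * (c * (r + c * (s - 1)) ^ 2) := by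
          have h3 : s ^ 2 ≤ 9 / 4 := by nlinarith [hs.1, hs.2]
          have h4 : (r / 2) ^ 2 ≤ (r + c * (s - 1)) ^ 2 := by gcongr
          have h5 : r ^ 2 * s ^ 2 ≤ 9 * (r + c * (s - 1)) ^ 2 := by
            nlinarith [mul_le_mul_of_nonneg_left h3 (sq_nonneg r)]
          nlinarith [mul_le_mul_of_nonneg_left h5 hc.le]
        rw [hH, abs_of_pos hc]
        simp only [← mul_assoc]
        gcongr ?_ * _
        rw [← ENNReal.ofReal_mul (by positivity)]
        refine (ENNReal.ofReal_le_ofReal h2).trans (le_of_eq ?_)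
        rw [ENNReal.ofReal_mul (by norm_num), ENNReal.ofReal_mul hc.le, ENNReal.ofReal_ofNat,
          mul_assoc]
    _ = 9 * ∫⁻ s in (fun s => r + c * (s - 1)) '' I, H s := by
        rw [lintegral_const_mul' _ _ (by norm_num),
          lintegral_image_eq_lintegral_abs_deriv_mul (f' := fun _ => c) measurableSet_Icc
            (fun s _ => ?_) (fun s _ t _ hst => ?_)]
        · have := (((hasDerivAt_id s).sub_const 1).const_mul c).const_add r
          simpa using this.hasDerivWithinAt
        · have : c * (s - 1) = c * (t - 1) := by simpa using hst
          have := mul_left_cancel₀ hc.ne' this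
          linarith
    _ ≤ 9 * ∫⁻ s in Ioi (0 : ℝ), H s := by
        gcongr
        rintro _ ⟨s, hs, rfl⟩
        exact lt_of_lt_of_le (by positivity) (hpos s hs)

/-- The decay estimate away from the spatial origin. It uses no equation for `f`. -/
theorem exists_exterior_bound {c : ℝ} (hc : 0 < c) : ∃ C : ℝ≥0, ∀ f : SpaceTime → ℝ,
    ContDiff ℝ ∞ f → ∀ (T : ℝ) (X : Space), c ≤ ‖X‖ →
      ENNReal.ofReal (‖X‖ ^ 2 * f (T, X) ^ 2) ≤
        C * ∫⁻ x : Space, ENNReal.ofReal (gammaDensity f (T, x)) := by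
  obtain ⟨K, hK⟩ := exists_local_sobolev (R₀ := 1 / 2) (by norm_num)
  obtain ⟨C, hC0, hC⟩ := exists_sobolevDensity_shift_le c
  refine ⟨K * (C * c⁻¹ * 9).toNNReal, fun f hf T X hX => ?_⟩
  set r := ‖X‖ with hr
  have hr0 : 0 < r := hc.trans_le hX
  set y₀ : Space := r⁻¹ • X with hy₀
  have hny : ‖y₀‖ = 1 := by
    rw [hy₀, norm_smul, ← hr, norm_inv, Real.norm_of_nonneg hr0.le, inv_mul_cancel₀ hr0.ne']
  have hΦ : radialShift r c y₀ = X := by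
    have := radialShift_smul (r := r) (c := c) one_pos hny
    rw [one_smul] at this
    rw [this, sub_self, mul_zero, add_zero, hy₀, smul_smul, mul_inv_cancel₀ hr0.ne', one_smul]
  have hball : Metric.closedBall y₀ (1 / 2) ⊆ shell := fun y hy => by
    rw [mem_closedBall_iff_norm] at hy
    rw [mem_shell]
    have h1 := norm_sub_norm_le y y₀
    have h2 := norm_sub_norm_le y₀ y
    rw [norm_sub_rev] at h2
    constructor <;> linarith
  have hmf : Measurable fun x : Space => f (T, x) := by
    have := hf.continuous
    exact Continuous.measurable (by fun_prop)
  have hsob := hK {0}ᶜ (fun y => f (T, radialShift r c y)) y₀ (1 / 2) isOpen_compl_singleton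
    (contDiffOn_comp_radialShift hf T r c) (hmf.comp (measurable_radialShift r c)) le_rfl
    fun y hy => ne_zero_of_mem_shell (hball hy)
  have hmg := measurable_ofReal_slice (continuous_gammaDensity hf) T
  have hshift := lintegral_shell_radialShift_le hmg hc hX
  rw [hΦ] at hsob
  have e : r ^ 2 = c⁻¹ * (c * r ^ 2) := by field_simp
  rw [ENNReal.ofReal_mul (by positivity)]
  calc ENNReal.ofReal (r ^ 2) * ENNReal.ofReal (f (T, X) ^ 2)
      ≤ ENNReal.ofReal (r ^ 2) * (K * ∫⁻ y in Metric.closedBall y₀ (1 / 2),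
          ENNReal.ofReal (sobolevDensity (1 / 2) (fun y => f (T, radialShift r c y)) y)) := by
        gcongr
    _ ≤ ENNReal.ofReal (r ^ 2) * (K * ∫⁻ y in shell,
          ENNReal.ofReal (sobolevDensity (1 / 2) (fun y => f (T, radialShift r c y)) y)) := by
        gcongr
    _ ≤ ENNReal.ofReal (r ^ 2) * (K * ∫⁻ y in shell, ENNReal.ofReal C *
          ENNReal.ofReal (gammaDensity f (T, radialShift r c y))) := by
        gcongr _ * (_ * ?_)
        refine setLIntegral_mono' isCompact_shell.measurableSet fun y hy => ?_
        rw [← ENNReal.ofReal_mul hC0]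
        exact ENNReal.ofReal_le_ofReal (hC f hf T r y hy)
    _ = K * (ENNReal.ofReal C * (ENNReal.ofReal c⁻¹ * (ENNReal.ofReal (c * r ^ 2) * ∫⁻ y in shell,
          ENNReal.ofReal (gammaDensity f (T, radialShift r c y))))) := by
        rw [lintegral_const_mul' _ _ ENNReal.ofReal_ne_top, e, ENNReal.ofReal_mul (by positivity),
          ← e]
        ring
    _ ≤ K * (ENNReal.ofReal C * (ENNReal.ofReal c⁻¹ *
          (9 * ∫⁻ x : Space, ENNReal.ofReal (gammaDensity f (T, x))))) := by
        gcongr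
    _ = _ := by
        have h9 : (9 : ℝ≥0∞) = ENNReal.ofReal 9 := by norm_num
        rw [h9, ← mul_assoc (ENNReal.ofReal c⁻¹), ← mul_assoc (ENNReal.ofReal C),
          ← ENNReal.ofReal_mul (by positivity), ← ENNReal.ofReal_mul hC0, ENNReal.coe_mul,
          mul_assoc, ← mul_assoc C]
        rfl

/-! ### The decay estimate -/

theorem Gamma_eq_zero_of_initial {v : SpaceTime → ℝ} (hv : ContDiff ℝ ∞ v) {a : ℝ}
    (h0 : ∀ (t : ℝ) (x : Space), t ≤ a → v (t, x) = 0) (i : GammaIndex) (t : ℝ) (x : Space)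
    (ht : t ≤ a) : Gamma i v (t, x) = 0 := by
  have h := fun j => pd_eq_zero_of_initial hv h0 j ht x
  rcases i with j | q
  · exact h j
  · simp [Gamma, Omega, h]

/-- The sum over `|α| ≤ 2` on the right-hand side of the estimate. -/
noncomputable def wordSum (a t : ℝ) (F : SpaceTime → ℝ) : ℝ≥0∞ :=
  ∑ n ∈ Finset.range 3, ∑ α : Fin n → GammaIndex, dyadicSum a t (GammaPow α F)

theorem dyadicSum_GammaPow_le_wordSum (a t : ℝ) (F : SpaceTime → ℝ) {n : ℕ} (hn : n < 3)
    (α : Fin n → GammaIndex) : dyadicSum a t (GammaPow α F) ≤ wordSum a t F :=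
  (Finset.single_le_sum (f := fun α : Fin n → GammaIndex => dyadicSum a t (GammaPow α F))
    (fun _ _ => zero_le) (Finset.mem_univ α)).trans
    (Finset.single_le_sum (f := fun n => ∑ α : Fin n → GammaIndex, dyadicSum a t (GammaPow α F))
      (fun _ _ => zero_le) (Finset.mem_range.2 hn))

theorem dyadicSum_le_wordSum (a t : ℝ) (F : SpaceTime → ℝ) :
    dyadicSum a t F ≤ wordSum a t F := by
  simpa [GammaPow] using dyadicSum_GammaPow_le_wordSum a t F (n := 0) (by norm_num) ![]

theorem dyadicSum_Gamma_le_wordSum (a t : ℝ) (F : SpaceTime → ℝ) (i : GammaIndex) :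
    dyadicSum a t (Gamma i F) ≤ wordSum a t F := by
  simpa [GammaPow] using dyadicSum_GammaPow_le_wordSum a t F (n := 1) (by norm_num) ![i]

theorem dyadicSum_Gamma_Gamma_le_wordSum (a t : ℝ) (F : SpaceTime → ℝ) (i j : GammaIndex) :
    dyadicSum a t (Gamma i (Gamma j F)) ≤ wordSum a t F := by
  simpa [GammaPow] using dyadicSum_GammaPow_le_wordSum a t F (n := 2) (by norm_num) ![i, j]

/-- The energy inequality, applied to all `Γ^α w` with `|α| ≤ 2`. -/
theorem lintegral_gammaDensity_pd_le_wordSum {w : SpaceTime → ℝ} (hw : ContDiff ℝ ∞ w) {a T : ℝ}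
    (ha : 0 < a) (haT : a ≤ T) (h0 : ∀ (t : ℝ) (x : Space), t ≤ a → w (t, x) = 0) (j : Fin 4) :
    ∫⁻ x : Space, ENNReal.ofReal (gammaDensity (pd j w) (T, x)) ≤
      (1 + Fintype.card GammaIndex + Fintype.card GammaIndex ^ 2) *
        (25 * wordSum a T (box w)) ^ 2 := by
  have hG := fun b => contDiff_Gamma hw b
  have z1 := fun b => Gamma_eq_zero_of_initial hw h0 b
  refine lintegral_gammaDensity_pd_le hw (fun m => ?_) (fun b m => ?_) (fun b d m => ?_) j
  · exact (sliceNorm_pd_le_dyadicSum hw ha haT h0 m).trans (dyadicSum_le_wordSum _ _ _)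
  · refine (sliceNorm_pd_le_dyadicSum (hG b) ha haT (z1 b) m).trans ?_
    rw [box_Gamma hw]
    exact dyadicSum_Gamma_le_wordSum _ _ _ _
  · refine (sliceNorm_pd_le_dyadicSum (contDiff_Gamma (hG d) b) ha haT
      (Gamma_eq_zero_of_initial (hG d) (z1 d) b) m).trans ?_
    rw [box_Gamma (hG d), box_Gamma hw]
    exact dyadicSum_Gamma_Gamma_le_wordSum _ _ _ _ _

/-- The pointwise bound for one partial derivative. The regions `|X| ≤ T / 2` and `|X| ≥ T / 2` are
treated separately. -/
theorem exists_pd_bound {a : ℝ} (ha : 0 < a) : ∃ C : ℝ≥0, ∀ w : SpaceTime → ℝ,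
    ContDiff ℝ ∞ w → (∀ (t : ℝ) (x : Space), t ≤ a → w (t, x) = 0) →
      ∀ (T : ℝ) (X : Space) (j : Fin 4), a ≤ T →
        ENNReal.ofReal (T * |pd j w (T, X)|) ≤ C * wordSum a T (box w) := by
  obtain ⟨C₁, hC₁⟩ := exists_interior_bound ha
  obtain ⟨C₂, hC₂⟩ := exists_exterior_bound (half_pos ha)
  set M : ℝ≥0 := 1 + Fintype.card GammaIndex + Fintype.card GammaIndex ^ 2 with hM
  set C₃ : ℝ≥0 := C₁ * (2500 * M + 8) + 2500 * M * C₂ with hC₃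
  refine ⟨C₃ + 1, fun w hw h0 T X j haT => ?_⟩
  have hT : 0 < T := ha.trans_le haT
  set S := wordSum a T (box w) with hS
  have hE : ∀ m, ∫⁻ x : Space, ENNReal.ofReal (gammaDensity (pd m w) (T, x)) ≤
      M * (25 * S) ^ 2 := fun m => by
    have := lintegral_gammaDensity_pd_le_wordSum hw ha haT h0 m
    rw [hM]
    push_cast
    exact this
  have key : ENNReal.ofReal (T ^ 2 * pd j w (T, X) ^ 2) ≤ C₃ * S ^ 2 := by
    rcases le_total ‖X‖ (T / 2) with hX | hX
    · have hF : ENNReal.ofReal T * sliceNorm (box w) T ≤ 2 * S :=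
        (ofReal_mul_sliceNorm_le ha haT _).trans (by gcongr; exact dyadicSum_le_wordSum _ _ _)
      have hF' : ENNReal.ofReal T * sliceNorm (pd j (box w)) T ≤ 2 * S :=
        (ofReal_mul_sliceNorm_le ha haT _).trans
          (by gcongr; exact dyadicSum_Gamma_le_wordSum a T (box w) (Sum.inl j))
      calc _ ≤ C₁ * ((∑ m, ∫⁻ x : Space, ENNReal.ofReal (gammaDensity (pd m w) (T, x))) +
            (ENNReal.ofReal T * sliceNorm (box w) T) ^ 2 +
            (ENNReal.ofReal T * sliceNorm (pd j (box w)) T) ^ 2) := hC₁ w hw T X j haT hX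
        _ ≤ C₁ * ((∑ _m : Fin 4, M * (25 * S) ^ 2) + (2 * S) ^ 2 + (2 * S) ^ 2) := by
            gcongr with m
            exact hE m
        _ = C₁ * (2500 * M + 8) * S ^ 2 := by
            simp only [Finset.sum_const, Finset.card_univ, Fintype.card_fin, nsmul_eq_mul]
            push_cast
            ring
        _ ≤ C₃ * S ^ 2 := by
            gcongr
            rw [hC₃]
            push_cast
            exact le_self_add
    · have h4 : T ^ 2 * pd j w (T, X) ^ 2 ≤ 4 * (‖X‖ ^ 2 * pd j w (T, X) ^ 2) := by
        have : T ^ 2 ≤ 4 * ‖X‖ ^ 2 := by nlinarith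
        nlinarith [mul_le_mul_of_nonneg_right this (sq_nonneg (pd j w (T, X)))]
      calc _ ≤ ENNReal.ofReal (4 * (‖X‖ ^ 2 * pd j w (T, X) ^ 2)) := ENNReal.ofReal_le_ofReal h4
        _ = 4 * ENNReal.ofReal (‖X‖ ^ 2 * pd j w (T, X) ^ 2) := by
            rw [ENNReal.ofReal_mul (by norm_num), ENNReal.ofReal_ofNat]
        _ ≤ 4 * (C₂ * (M * (25 * S) ^ 2)) := by
            gcongr
            refine (hC₂ (pd j w) (contDiff_pd hw j) T X (by linarith)).trans ?_
            gcongr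
            exact hE j
        _ = 2500 * M * C₂ * S ^ 2 := by ring
        _ ≤ C₃ * S ^ 2 := by
            gcongr
            rw [hC₃]
            push_cast
            exact le_add_self
  rw [← ENNReal.pow_le_pow_left_iff (n := 2) (by norm_num), ← ENNReal.ofReal_pow (by positivity),
    mul_pow, sq_abs, mul_pow]
  refine key.trans ?_
  gcongr
  have : C₃ ≤ (C₃ + 1) ^ 2 := by
    calc C₃ ≤ C₃ + (C₃ ^ 2 + C₃ + 1) := le_self_add
      _ = (C₃ + 1) ^ 2 := by ring
  exact_mod_cast this

theorem gradNorm_le_sum_abs (f : SpaceTime → ℝ) (p : SpaceTime) :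
    gradNorm f p ≤ ∑ j, |pd j f p| := by
  refine Real.sqrt_le_iff.2 ⟨by positivity, ?_⟩
  simpa using Finset.sum_sq_le_sq_sum_of_nonneg (s := Finset.univ) (f := fun j => |pd j f p|)
    fun _ _ => abs_nonneg _

end WaveDecay


theorem proposition3p1 (B : ℝ) (hB : 0 < B) :
    ∃ C : ℝ≥0, ∀ w : WaveDecay.SpaceTime → ℝ, ContDiff ℝ ∞ w →
      (∀ (t : ℝ) (x : WaveDecay.Space), t ≤ 2 * B → w (t, x) = 0) →
      (∀ (t : ℝ) (x : WaveDecay.Space), t - B < ‖x‖ → WaveDecay.box w (t, x) = 0) →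
      ∀ t : ℝ,
        ENNReal.ofReal (1 + t) *
            (⨆ x : WaveDecay.Space, ENNReal.ofReal (WaveDecay.gradNorm w (t, x))) ≤
          (C : ℝ≥0∞) * ∑ n ∈ Finset.range 3, ∑ α : Fin n → WaveDecay.GammaIndex,
            WaveDecay.dyadicSum (2 * B) t
              (WaveDecay.GammaPow α (WaveDecay.box w)) := by
  obtain ⟨C, hC⟩ := WaveDecay.exists_pd_bound (a := 2 * B) (by positivity)
  set κ : ℝ := 1 + (2 * B)⁻¹ with hκ
  have hκ0 : 0 ≤ κ := by positivity
  refine ⟨κ.toNNReal * (4 * C), fun w hw h0 _ t => ?_⟩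
  rw [ENNReal.mul_iSup]
  refine iSup_le fun x => ?_
  rcases le_or_gt t (2 * B) with ht | ht
  · have : WaveDecay.gradNorm w (t, x) = 0 := by
      simp [WaveDecay.gradNorm, WaveDecay.pd_eq_zero_of_initial hw h0 _ ht]
    simp [this]
  have ht0 : 0 < t := by linarith
  -- since `t ≥ 2 B`, the weight `1 + t` is comparable to `t`
  have h1 : 1 + t ≤ κ * t := by
    have : 1 ≤ (2 * B)⁻¹ * t := by
      rw [inv_mul_eq_div, one_le_div (by positivity)]
      exact ht.le
    rw [hκ]
    linarith
  calc ENNReal.ofReal (1 + t) * ENNReal.ofReal (WaveDecay.gradNorm w (t, x))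
      ≤ ENNReal.ofReal (κ * t) * ENNReal.ofReal (∑ j, |WaveDecay.pd j w (t, x)|) := by
        gcongr
        exact WaveDecay.gradNorm_le_sum_abs w (t, x)
    _ = ENNReal.ofReal κ * ∑ j, ENNReal.ofReal (t * |WaveDecay.pd j w (t, x)|) := by
        rw [ENNReal.ofReal_mul hκ0, mul_assoc, ← ENNReal.ofReal_mul ht0.le, Finset.mul_sum,
          ENNReal.ofReal_sum_of_nonneg fun _ _ => by positivity]
    _ ≤ ENNReal.ofReal κ * ∑ _j : Fin 4, C * WaveDecay.wordSum (2 * B) t (WaveDecay.box w) := by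
        gcongr with j
        exact hC w hw h0 t x j ht.le
    _ = (κ.toNNReal * (4 * C) : ℝ≥0) * WaveDecay.wordSum (2 * B) t (WaveDecay.box w) := by
        simp only [Finset.sum_const, Finset.card_univ, Fintype.card_fin, nsmul_eq_mul]
        push_cast
        rw [ENNReal.ofReal]
        ring
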